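/- Let $\Omega=\{x\in\mathbb{R}^3:|x|=1\}$ with surface element $d\omega$, surface gradient $\nabla^*$ and Beltrami operator $\Delta^*$ (so $\Delta_x=\frac1{r^2}\partial_r r^2\partial_r+\frac1{r^2}\Delta^*_\xi$ for $x=r\xi$, $|\xi|=1$). Let $\zeta\in\Omega$, $\rho\in(0,2)$, and let $\Gamma=\Gamma_\rho(\zeta)=\{\eta\in\Omega:1-\zeta\cdot\eta<\rho\}$ be the spherical cap, $\|\Gamma\|$ its surface area, $\partial\Gamma$ its boundary circle with line element $d\sigma$, and $\nu$ the outward unit normal on $\partial\Gamma$ tangential to $\Omega$. Put $\frac{\partial}{\partial\nu}F(\eta)=\nu(\eta)\cdot\nabla^*F(\eta)$, and for $\eta\in\partial\Gamma$ $$\frac{\partial}{\partial\nu}F^-(\eta)=\lim_{\tau\to0+}\nu(\eta)\cdot\nabla^*F\Big(\frac{\eta-\tau\nu(\eta)}{\sqrt{1+\tau^2}}\Big).$$ Let $G(\Delta^*;t)=\frac1{4\pi}\ln(1-t)+\frac1{4\pi}(1-\ln 2)$ be the fundamental solution of $\Delta^*$. A function $G_N(\Delta^*;\cdot,\cdot)$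 is called a Neumann Green function for $\Gamma$ if $$G_N(\Delta^*;\xi,\eta)=G(\Delta^*;\xi\cdot\eta)-\Phi_N(\xi,\eta),\qquad \eta\in\overline\Gamma,\ \xi\in\Gamma,\ \xi\ne\eta,$$ where for every $\xi\in\Gamma$ the function $\Phi_N(\xi,\cdot)$ is of class $C^{(2)}(\Gamma)\cap C^{(1)}(\overline\Gamma)$ and satisfies $\Delta^*_\eta\Phi_N(\xi,\eta)=\frac1{\|\Gamma\|}-\frac1{4\pi}$ for $\eta\in\Gamma$ and $\frac{\partial}{\partial\nu(\eta)}\Phi_N^-(\xi,\eta)=\frac{\partial}{\partial\nu(\eta)}G(\Delta^*;\xi\cdot\eta)$ for $\eta\in\partial\Gamma$. For $\xi\in\Gamma$ set $$\check r=-\frac{1+2\,\xi\cdot\zeta\,(\rho-1)+(\rho-1)^2}{\rho(\rho-2)},\qquad \check\xi=\frac1{\check r}\,\xi-\frac{\check r-1}{\check r(\rho-1)}\,\zeta\quad(\rho\neq1),$$ and, for $\rho=1$ (where $\check r=1$), let $\check\xi=\xi-2(\xi\cdot\zeta)\zeta$, which is the limit of the preceding formula as $\rho\to1$. Theorem. (1)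 A Neumann Green function for $\Gamma=\Gamma_\rho(\zeta)$ is given by $$G_N(\Delta^*;\xi,\eta)=\frac{1}{4\pi}\ln(1-\xi\cdot\eta)+\frac{1}{4\pi}\ln\big(\check r(1-\check\xi\cdot\eta)\big)+\frac{1-\rho}{2\pi\rho}\ln(1+\zeta\cdot\eta).$$ (2) Let $F\in C^{(0)}(\partial\Gamma)$ and let $U\in C^{(2)}(\overline\Gamma)$ be a solution of the Neumann problem $\Delta^*U=0$ in $\Gamma$, $\frac{\partial}{\partial\nu}U^-=F$ on $\partial\Gamma$. Then for all $\xi\in\Gamma_\rho(\zeta)$ $$U(\xi)=\frac{1}{2\pi\rho}\int_{\Gamma_\rho(\zeta)}U(\eta)\,d\omega(\eta)-\int_{\partial\Gamma_\rho(\zeta)}\Big(\frac1{2\pi}\ln(1-\xi\cdot\eta)+\frac{1-\rho}{2\pi\rho}\ln(2-\rho)\Big)F(\eta)\,d\sigma(\eta).$$ -/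

import Mathlib

open Real Set Filter Topology MeasureTheory
open scoped RealInnerProductSpace

noncomputable section

/-- Euclidean three-space. -/
abbrev E3 : Type := EuclideanSpace ℝ (Fin 3)

/-- The unit sphere `Ω` in `ℝ³`. Scalar functions on (subsets of) `Ω` are represented by functions
`E3 → ℝ`, of which only the values on `Ω` are ever used. -/
def unitSphere : Set E3 := Metric.sphere 0 1

/-- The extension of a function on the sphere that is constant along rays: `x ↦ F (x / |x|)`. -/
def radialExt (F : E3 → ℝ) : E3 → ℝ := fun x => F (‖x‖⁻¹ • x)

/-- The cone `{x ≠ 0 : x / |x| ∈ S}` over a subset `S` of the sphere. -/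
def coneOver (S : Set E3) : Set E3 := {x | x ≠ 0 ∧ ‖x‖⁻¹ • x ∈ S}

/-- `F` is of class `C^(k)` on the subset `S` of the sphere. For relatively open `S` this is
ordinary `C^k` smoothness on `S` as a submanifold; for the closure of a smoothly bounded region it
is `C^k` smoothness up to the boundary. -/
def SphereContDiffOn (k : WithTop ℕ∞) (F : E3 → ℝ) (S : Set E3) : Prop :=
  ContDiffOn ℝ k (radialExt F) (coneOver S)

/-- The surface gradient `∇*F(ξ)`, the tangential part of the Euclidean gradient at `ξ ∈ Ω`
(the radial derivative of the radially constant extension vanishes). -/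
def surfaceGradient (F : E3 → ℝ) (ξ : E3) : E3 := gradient (radialExt F) ξ

/-- The Beltrami operator `Δ*F(ξ)`, `ξ ∈ Ω`. It is the tangential part of
`Δ = r⁻² ∂_r r² ∂_r + r⁻² Δ*`, hence equals the Euclidean Laplacian, at `|ξ| = 1`, of the radially
constant extension. -/
def beltrami (F : E3 → ℝ) (ξ : E3) : ℝ := Laplacian.laplacian (radialExt F) ξ

/-- The surface measure `dω` of the unit sphere, as a measure on `ℝ³` carried by the sphere. -/
def surfaceMeasure : Measure E3 :=
  Measure.map (Subtype.val : Metric.sphere (0 : E3) 1 → E3) (volume : Measure E3).toSphere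

/-- The line element `dσ` in `ℝ³`: the one-dimensional Hausdorff measure (arc length). -/
def lineMeasure : Measure E3 := Measure.hausdorffMeasure 1

/-- The boundary `∂Γ` in the sphere of a relatively open subset `Γ` of the sphere. -/
def boundaryOf (Γ : Set E3) : Set E3 := closure Γ \ Γ

/-- The normal derivative `∂F/∂ν (η) = ν(η) · ∇*F(η)`. -/
def normalDeriv (ν : E3 → E3) (F : E3 → ℝ) (η : E3) : ℝ := ⟪ν η, surfaceGradient F η⟫

/-- The one-sided normal derivative `∂F⁻/∂ν (η)` at a boundary point `η` exists and equals `a`: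
`ν(η) · ∇*F` tends to `a` along the points `(η - τ ν(η)) / √(1 + τ²)`, `τ → 0+`. -/
def HasInnerNormalDeriv (ν : E3 → E3) (F : E3 → ℝ) (η : E3) (a : ℝ) : Prop :=
  Tendsto (fun τ : ℝ => ⟪ν η, surfaceGradient F ((√(1 + τ ^ 2))⁻¹ • (η - τ • ν η))⟫)
    (𝓝[>] 0) (𝓝 a)

/-- The fundamental solution `G(Δ*; t)` of the Beltrami operator. -/
def fundSol (t : ℝ) : ℝ := 1 / (4 * π) * log (1 - t) + 1 / (4 * π) * (1 - log 2)

/-- `GN` is a Neumann Green function for the Beltrami operator on the region `Γ` with outward unit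
normal `ν`. -/
def IsNeumannGreenFunction (Γ : Set E3) (ν : E3 → E3) (GN : E3 → E3 → ℝ) : Prop :=
  ∃ Φ : E3 → E3 → ℝ,
    (∀ ξ ∈ Γ, ∀ η ∈ closure Γ, ξ ≠ η → GN ξ η = fundSol ⟪ξ, η⟫ - Φ ξ η) ∧
    ∀ ξ ∈ Γ,
      SphereContDiffOn 2 (Φ ξ) Γ ∧
      SphereContDiffOn 1 (Φ ξ) (closure Γ) ∧
      (∀ η ∈ Γ, beltrami (Φ ξ) η = 1 / surfaceMeasure.real Γ - 1 / (4 * π)) ∧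
      ∀ η ∈ boundaryOf Γ,
        HasInnerNormalDeriv ν (Φ ξ) η (normalDeriv ν (fun y => fundSol ⟪ξ, y⟫) η)

/-- `U` solves the Neumann problem on the region `Γ` (outward unit normal `ν`) with data `F`. -/
structure IsNeumannSolution (Γ : Set E3) (ν : E3 → E3) (F U : E3 → ℝ) : Prop where
  contDiffOn : SphereContDiffOn 2 U Γ
  continuousOn : ContinuousOn U (closure Γ)
  harmonic : ∀ ξ ∈ Γ, beltrami U ξ = 0
  normal : ∀ ξ ∈ boundaryOf Γ, HasInnerNormalDeriv ν U ξ (F ξ)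

/-- The spherical cap `Γ_ρ(ζ) = {η ∈ Ω : 1 - ζ·η < ρ}`. -/
def sphericalCap (ζ : E3) (ρ : ℝ) : Set E3 := {η | η ∈ unitSphere ∧ 1 - ⟪ζ, η⟫ < ρ}

/-- The outward unit normal at the boundary points `η` of a cap with center `ζ`: the normalized
tangential part at `η` of `-ζ`. -/
def capNormal (ζ η : E3) : E3 := -(‖ζ - ⟪ζ, η⟫ • η‖⁻¹ • (ζ - ⟪ζ, η⟫ • η))

/-- The scaling factor `ř` belonging to a point `ξ` of the cap. -/
def scalingFactor (ζ : E3) (ρ : ℝ) (ξ : E3) : ℝ :=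
  -((1 + 2 * ⟪ξ, ζ⟫ * (ρ - 1) + (ρ - 1) ^ 2) / (ρ * (ρ - 2)))

/-- The reflection point of a point `ξ` of the cap. For `ρ = 1`, where `ř = 1` and the quotient
`(ř - 1) / (ρ - 1)` is undefined, it is the limit `ρ → 1` of the general formula, the mirror image
of `ξ` in the boundary plane of the hemisphere. -/
def reflectionPoint (ζ : E3) (ρ : ℝ) (ξ : E3) : E3 :=
  if ρ = 1 then ξ - (2 * ⟪ξ, ζ⟫) • ζ
  else (1 / scalingFactor ζ ρ ξ) • ξ -
    ((scalingFactor ζ ρ ξ - 1) / (scalingFactor ζ ρ ξ * (ρ - 1))) • ζ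

/-- The explicit Neumann Green function of the cap `Γ_ρ(ζ)`. -/
def capNeumannGreen (ζ : E3) (ρ : ℝ) (ξ η : E3) : ℝ :=
  1 / (4 * π) * log (1 - ⟪ξ, η⟫) +
    1 / (4 * π) * log (scalingFactor ζ ρ ξ * (1 - ⟪reflectionPoint ζ ρ ξ, η⟫)) +
    (1 - ρ) / (2 * π * ρ) * log (1 + ⟪ζ, η⟫)

end

/-! For a unit vector b, the function η ↦ log(1 - b·η) has Beltrami derivative -1 away from b
(`laplacian_radialLog`). For part (1), Φ_N is therefore a constant plus multiples of two such
potentials, with poles at the reflection point ξ̌ and at -ζ, both outside the closed cap. The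
coefficients give Δ*Φ_N = 1/(4π) + (1-ρ)/(2πρ) = 1/(2πρ) - 1/(4π), which is the required constant
because the cap has area 2πρ (`surfaceMeasure_sphericalCap`). On the boundary circle 1 - ξ·η = ř(1 -
ξ̌·η), and the potentials at ξ and ξ̌ together have constant normal derivative there; the potential
at -ζ cancels it (`isNeumannGreenFunction_cap`).

Part (2) does not integrate against G_N. Stereographic projection from -ζ maps the cap conformally
onto a disc centred at 0, so U becomes a planar harmonic function u (`laplacian_comp_stereo`,
`harmonicOnNhd_comp_chart`). Its radial derivative V = r∂_r u extends continuously to the boundary,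
with values a constant multiple of F (`continuousOn_radialDeriv`); this is where C² up to the
boundary enters. Dini's formula `HarmonicOnNhd.sub_eq_circleAverage_log` then recovers u(z₀) - u(0)
from the average of log|z₀ - z| V over the boundary circle, and shows that V has average 0.

Two observations translate this back. First, 1 - ξ·η is 2|z₀ - z|² divided by a factor constant in η
on ∂Γ (`one_sub_inner_chart`), so the spherical and planar kernels differ by a constant, which is
invisible because V has average 0. Secondly, the mean value property on every parallel circle makes
u(0) the mean of U over the cap (`integral_sphericalCap_eq`). The line integral is defined by
Hausdorff measure, so the arc length of a circle is computed separately
(`hausdorffMeasure_circleMap_image`). -/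

/-! ### Dini's formula for the Neumann problem in a planar disc -/

section DiscNeumann

open Metric InnerProductSpace

/-- The circle average of `z ↦ z g'(z)` vanishes. -/
theorem circleAverage_mul_deriv_eq_zero {g g' : ℂ → ℂ} {r : ℝ} (hr : 0 < r)
    (h : ∀ z ∈ sphere (0 : ℂ) r, HasDerivAt g (g' z) z) :
    circleAverage (fun z => z * g' z) 0 r = 0 := by
  rw [circleAverage_eq_circleIntegral hr.ne']
  have : (∮ z in C(0, r), (z - 0)⁻¹ • (z * g' z)) = ∮ z in C(0, r), g' z := by
    refine circleIntegral.integral_congr hr.le fun z hz => ?_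
    have hz0 : z ≠ 0 := ne_of_mem_sphere hz hr.ne'
    simp [hz0]
  rw [this, circleIntegral.integral_eq_zero_of_hasDerivWithinAt hr.le
    fun z hz => (h z hz).hasDerivWithinAt, smul_zero]

theorem one_sub_div_mem_slitPlane {z₀ z : ℂ} (h : ‖z₀‖ < ‖z‖) : 1 - z₀ / z ∈ Complex.slitPlane := by
  have := Complex.mem_slitPlane_of_norm_lt_one (z := -(z₀ / z)) (by
    rw [norm_neg, norm_div]
    exact (div_lt_one ((norm_nonneg _).trans_lt h)).2 h)
  simpa [sub_eq_add_neg] using this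

/-- Integration by parts on the circle. Since |z₀| < r, log(1 - z₀/z) is single-valued there, and z
times the derivative of log(1 - z₀/z) f is log(1 - z₀/z) z f' + z/(z - z₀) f - f. This has average
0, while Cauchy's formula gives the last two terms the averages f(z₀) and f(0). -/
theorem circleAverage_log_mul_deriv {f : ℂ → ℂ} {r R : ℝ} (hr : 0 < r) (hrR : r < R)
    (hf : AnalyticOnNhd ℂ f (ball 0 R)) {z₀ : ℂ} (hz₀ : ‖z₀‖ < r) :
    circleAverage (fun z => Complex.log (1 - z₀ / z) * (z * deriv f z)) 0 r = -(f z₀ - f 0) := by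
  have hcb : closedBall (0 : ℂ) r ⊆ ball 0 R := closedBall_subset_ball hrR
  have hsb : sphere (0 : ℂ) r ⊆ ball 0 R := sphere_subset_closedBall.trans hcb
  have hfc : ContinuousOn f (sphere 0 r) := hf.continuousOn.mono hsb
  have hf'c : ContinuousOn (deriv f) (sphere 0 r) := hf.deriv.continuousOn.mono hsb
  have hz0 : ∀ z ∈ sphere (0 : ℂ) r, z ≠ 0 := fun z hz => ne_of_mem_sphere hz hr.ne'
  have hzz : ∀ z ∈ sphere (0 : ℂ) r, z - z₀ ≠ 0 := fun z hz h => by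
    rw [sub_eq_zero] at h
    rw [mem_sphere_zero_iff_norm] at hz
    rw [← h, hz] at hz₀
    exact lt_irrefl _ hz₀
  have hslit : ∀ z ∈ sphere (0 : ℂ) r, 1 - z₀ / z ∈ Complex.slitPlane := fun z hz =>
    one_sub_div_mem_slitPlane (by rw [mem_sphere_zero_iff_norm.1 hz]; exact hz₀)
  have hLc : ContinuousOn (fun z => Complex.log (1 - z₀ / z)) (sphere (0 : ℂ) r) :=
    (continuousOn_const.sub (continuousOn_const.div continuousOn_id hz0)).clog hslit
  have hder : ∀ z ∈ sphere (0 : ℂ) r, HasDerivAt (fun z => Complex.log (1 - z₀ / z) * f z)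
      (z⁻¹ * (Complex.log (1 - z₀ / z) * (z * deriv f z) + (z / (z - z₀) * f z - f z))) z := by
    intro z hz
    have h1 : HasDerivAt (fun z : ℂ => 1 - z₀ / z) (z₀ / z ^ 2) z := by
      have := ((hasDerivAt_const z z₀).fun_div (hasDerivAt_id' z) (hz0 z hz)).const_sub 1
      simpa [neg_div] using this
    have h2 := (h1.clog (hslit z hz)).mul (hf z (hsb hz)).differentiableAt.hasDerivAt
    refine h2.congr_deriv ?_
    have a1 := hz0 z hz
    have a2 := hzz z hz
    have a3 : 1 - z₀ / z ≠ 0 := Complex.slitPlane_ne_zero (hslit z hz)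
    have e : 1 - z₀ / z = (z - z₀) / z := by field_simp
    rw [show z₀ / z ^ 2 / (1 - z₀ / z) = z₀ / (z * (z - z₀)) by rw [e]; field_simp]
    field_simp
    ring
  have key := circleAverage_mul_deriv_eq_zero hr hder
  have c1 : CircleIntegrable (fun z => Complex.log (1 - z₀ / z) * (z * deriv f z)) 0 r :=
    (hLc.mul (continuousOn_id.mul hf'c)).circleIntegrable hr.le
  have c2 : CircleIntegrable (fun z => z / (z - z₀) * f z) 0 r :=
    ((continuousOn_id.div (continuousOn_id.sub continuousOn_const) hzz).mul hfc).circleIntegrable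
      hr.le
  have c3 : CircleIntegrable f 0 r := hfc.circleIntegrable hr.le
  have hcongr : circleAverage (fun z => z * (z⁻¹ * (Complex.log (1 - z₀ / z) * (z * deriv f z) +
      (z / (z - z₀) * f z - f z)))) 0 r =
      circleAverage (fun z => Complex.log (1 - z₀ / z) * (z * deriv f z) +
      (z / (z - z₀) * f z - f z)) 0 r := by
    refine circleAverage_congr_sphere fun z hz => ?_
    rw [abs_of_pos hr] at hz
    have := hz0 z hz
    simp only [mul_inv_cancel_left₀ this]
  have c23 : CircleIntegrable (fun z => z / (z - z₀) * f z - f z) 0 r := c2.sub c3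
  rw [hcongr, circleAverage_fun_add c1 c23, circleAverage_fun_sub c2 c3] at key
  have hd : DiffContOnCl ℂ f (ball 0 |r|) := by
    rw [abs_of_pos hr]
    refine DifferentiableOn.diffContOnCl ?_
    rw [closure_ball _ hr.ne']
    exact hf.differentiableOn.mono hcb
  have e1 : circleAverage (fun z => z / (z - z₀) * f z) 0 r = f z₀ := by
    have := hd.circleAverage_smul_div (w := z₀) (by simpa [abs_of_pos hr] using hz₀)
    simpa using this
  rw [e1, hd.circleAverage] at key
  linear_combination key

/-- Put L = log(1 - z₀/z) and G = z f', so that log|z₀ - z| = log r + Re L and Re L · Re G = Re(LG +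
L̄G)/2. The term LG is the preceding lemma. On the circle L̄ = log(1 - z̄₀z/r²), which is
holomorphic in the disc, so L̄G and log r · G average to their values at 0, which vanish with G(0) =
0. -/
theorem circleAverage_log_norm_mul_re {f : ℂ → ℂ} {r R : ℝ} (hr : 0 < r) (hrR : r < R)
    (hf : AnalyticOnNhd ℂ f (ball 0 R)) {z₀ : ℂ} (hz₀ : ‖z₀‖ < r) :
    circleAverage (fun z => log ‖z₀ - z‖ * (z * deriv f z).re) 0 r
      = -(1 / 2) * ((f z₀).re - (f 0).re) := by
  have hcb : closedBall (0 : ℂ) r ⊆ ball 0 R := closedBall_subset_ball hrR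
  have hsb : sphere (0 : ℂ) r ⊆ ball 0 R := sphere_subset_closedBall.trans hcb
  have hz0 : ∀ z ∈ sphere (0 : ℂ) r, z ≠ 0 := fun z hz => ne_of_mem_sphere hz hr.ne'
  have hslit : ∀ z ∈ sphere (0 : ℂ) r, 1 - z₀ / z ∈ Complex.slitPlane := fun z hz =>
    one_sub_div_mem_slitPlane (by rw [mem_sphere_zero_iff_norm.1 hz]; exact hz₀)
  have hslit' : ∀ z ∈ closedBall (0 : ℂ) r,
      1 - star z₀ * z / (r : ℂ) ^ 2 ∈ Complex.slitPlane := by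
    intro z hz
    have := Complex.mem_slitPlane_of_norm_lt_one (z := -(star z₀ * z / (r : ℂ) ^ 2)) (by
      rw [norm_neg, norm_div, norm_mul, norm_star, norm_pow, Complex.norm_real, norm_eq_abs,
        abs_of_pos hr, div_lt_one (by positivity)]
      rw [mem_closedBall_zero_iff] at hz
      nlinarith [norm_nonneg z₀, norm_nonneg z])
    simpa [sub_eq_add_neg] using this
  have hG : AnalyticOnNhd ℂ (fun z => z * deriv f z) (ball 0 R) :=
    analyticOnNhd_id.mul hf.deriv
  have hGc : ContinuousOn (fun z => z * deriv f z) (sphere 0 r) := hG.continuousOn.mono hsb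
  have hdG : DiffContOnCl ℂ (fun z => z * deriv f z) (ball 0 |r|) := by
    rw [abs_of_pos hr]
    refine DifferentiableOn.diffContOnCl ?_
    rw [closure_ball _ hr.ne']
    exact hG.differentiableOn.mono hcb
  have hM : DifferentiableOn ℂ (fun z : ℂ => Complex.log (1 - star z₀ * z / (r : ℂ) ^ 2))
      (closedBall 0 r) := by
    refine DifferentiableOn.clog ?_ hslit'
    fun_prop
  have hdM : DiffContOnCl ℂ (fun z : ℂ => Complex.log (1 - star z₀ * z / (r : ℂ) ^ 2) *
      (z * deriv f z)) (ball 0 |r|) := by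
    rw [abs_of_pos hr]
    refine DifferentiableOn.diffContOnCl ?_
    rw [closure_ball _ hr.ne']
    exact hM.mul (hG.differentiableOn.mono hcb)
  have hLc : ContinuousOn (fun z => Complex.log (1 - z₀ / z)) (sphere (0 : ℂ) r) :=
    (continuousOn_const.sub (continuousOn_const.div continuousOn_id hz0)).clog hslit
  have i1 : CircleIntegrable (fun z => (log r : ℂ) * (z * deriv f z)) 0 r :=
    (continuousOn_const.mul hGc).circleIntegrable hr.le
  have i2 : CircleIntegrable
      (fun z => (1 / 2 : ℂ) * (Complex.log (1 - z₀ / z) * (z * deriv f z))) 0 r :=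
    (continuousOn_const.mul (hLc.mul hGc)).circleIntegrable hr.le
  have i3 : CircleIntegrable (fun z => (1 / 2 : ℂ) *
      (Complex.log (1 - star z₀ * z / (r : ℂ) ^ 2) * (z * deriv f z))) 0 r :=
    (continuousOn_const.mul ((hM.continuousOn.mono sphere_subset_closedBall).mul
      hGc)).circleIntegrable hr.le
  have i12 : CircleIntegrable (fun z => (log r : ℂ) * (z * deriv f z) +
      (1 / 2 : ℂ) * (Complex.log (1 - z₀ / z) * (z * deriv f z))) 0 r := i1.add i2
  have i123 : CircleIntegrable (fun z => (log r : ℂ) * (z * deriv f z) +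
      (1 / 2 : ℂ) * (Complex.log (1 - z₀ / z) * (z * deriv f z)) + (1 / 2 : ℂ) *
      (Complex.log (1 - star z₀ * z / (r : ℂ) ^ 2) * (z * deriv f z))) 0 r := i12.add i3
  have key : circleAverage (fun z => (log r : ℂ) * (z * deriv f z) +
      (1 / 2 : ℂ) * (Complex.log (1 - z₀ / z) * (z * deriv f z)) + (1 / 2 : ℂ) *
      (Complex.log (1 - star z₀ * z / (r : ℂ) ^ 2) * (z * deriv f z))) 0 r =
      -(1 / 2) * (f z₀ - f 0) := by
    rw [circleAverage_fun_add i12 i3, circleAverage_fun_add i1 i2]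
    simp only [← smul_eq_mul (α := ℂ) (a := (log r : ℂ)), ← smul_eq_mul (α := ℂ) (a := (1 / 2 : ℂ))]
    rw [circleAverage_fun_smul, circleAverage_fun_smul, circleAverage_fun_smul,
      circleAverage_log_mul_deriv hr hrR hf hz₀, hdG.circleAverage, hdM.circleAverage]
    simp
    ring
  have hre := congrArg Complex.re key
  rw [← Complex.reCLM_apply, ← Complex.reCLM.circleAverage_comp_comm i123] at hre
  have : (-(1 / 2) * (f z₀ - f 0) : ℂ).re = -(1 / 2) * ((f z₀).re - (f 0).re) := by
    have : (-(1 / 2) : ℂ) = ((-(1 / 2) : ℝ) : ℂ) := by push_cast; rfl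
    rw [this, Complex.re_ofReal_mul, Complex.sub_re]
  rw [← this, ← hre]
  refine circleAverage_congr_sphere fun z hz => ?_
  rw [abs_of_pos hr] at hz
  have hzn : ‖z‖ = r := mem_sphere_zero_iff_norm.1 hz
  have hzne := hz0 z hz
  have hconj : Complex.log (1 - star z₀ * z / (r : ℂ) ^ 2) = star (Complex.log (1 - z₀ / z)) := by
    have : (1 - star z₀ * z / (r : ℂ) ^ 2) = star (1 - z₀ / z) := by
      have h1 : z * star z = (r : ℂ) ^ 2 := by
        have := Complex.mul_conj' z
        rw [hzn] at this
        exact this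
      have h2 : star z ≠ 0 := by simpa using hzne
      have h3 : (r : ℂ) ≠ 0 := by exact_mod_cast hr.ne'
      rw [star_sub, star_one, star_div₀, ← h1]
      field_simp
    rw [this]
    exact Complex.log_conj _ (Complex.slitPlane_arg_ne_pi (hslit z hz))
  have hlog : log ‖z₀ - z‖ = log r + (Complex.log (1 - z₀ / z)).re := by
    rw [Complex.log_re, ← Real.log_mul hr.ne' (by
      simpa using Complex.slitPlane_ne_zero (hslit z hz)), ← hzn, ← norm_mul, norm_sub_rev]
    congr 2
    field_simp
  simp only [Function.comp, Complex.reCLM_apply, hconj, hlog]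
  simp only [Complex.add_re, Complex.re_ofReal_mul]
  have : (1 / 2 : ℂ) = ((1 / 2 : ℝ) : ℂ) := by push_cast; rfl
  rw [this]
  simp only [Complex.re_ofReal_mul]
  simp [Complex.mul_re]
  ring

theorem continuousOn_log_norm_sub_mul {V : ℂ → ℝ} {R : ℝ} {z₀ : ℂ}
    (hV : ContinuousOn V (closedBall 0 R)) :
    ContinuousOn (fun z => log ‖z₀ - z‖ * V z) {z | ‖z - 0‖ ∈ Ioc ‖z₀‖ R} := by
  refine ContinuousOn.mul (ContinuousOn.log (by fun_prop) fun z hz => ?_) (hV.mono fun z hz => ?_)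
  · rw [norm_ne_zero_iff, sub_ne_zero]
    rintro rfl
    simp at hz
  · simpa using hz.2

/-- **Neumann problem in the disc** (Dini's formula): the radial derivative `V = r ∂_r u` at the
boundary determines a harmonic function up to its value at the centre. -/
theorem HarmonicOnNhd.sub_eq_circleAverage_log {u V : ℂ → ℝ} {R : ℝ}
    (hu : HarmonicOnNhd u (ball 0 R)) (hV : ContinuousOn V (closedBall 0 R))
    (huV : ∀ z ∈ ball (0 : ℂ) R, V z = fderiv ℝ u z z) {z₀ : ℂ} (hz₀ : ‖z₀‖ < R) :
    u z₀ - u 0 = -2 * circleAverage (fun z => log ‖z₀ - z‖ * V z) 0 R ∧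
      circleAverage V 0 R = 0 := by
  obtain ⟨f, hf, hfu⟩ := hu.exists_analyticOnNhd_ball_re_eq
  have hVf : ∀ z ∈ ball (0 : ℂ) R, V z = (z * deriv f z).re := by
    intro z hz
    rw [huV z hz]
    have h1 : HasFDerivAt (fun z => (f z).re) _ z :=
      Complex.reCLM.hasFDerivAt.comp z ((hf z hz).differentiableAt.hasFDerivAt.restrictScalars ℝ)
    have h2 : (fun z => (f z).re) =ᶠ[𝓝 z] u := by
      filter_upwards [isOpen_ball.mem_nhds hz] with y hy using hfu hy
    rw [(h1.congr_of_eventuallyEq h2.symm).fderiv]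
    simp
  -- Harmonicity holds only in the open disc, so the identities are first proved on circles of
  -- radius r < R.
  have hrad : ∀ r ∈ Ioo ‖z₀‖ R,
      circleAverage (fun z => log ‖z₀ - z‖ * V z) 0 r = -(1 / 2) * (u z₀ - u 0) ∧
      circleAverage V 0 r = 0 := by
    intro r hr
    have hr0 : 0 < r := (norm_nonneg _).trans_lt hr.1
    have hsb : sphere (0 : ℂ) |r| ⊆ ball 0 R := by
      rw [abs_of_pos hr0]
      exact sphere_subset_closedBall.trans (closedBall_subset_ball hr.2)
    constructor
    · rw [← hfu (by simpa using hz₀), ← hfu (by simpa using (norm_nonneg _).trans_lt hz₀),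
        ← circleAverage_log_norm_mul_re hr0 hr.2 hf hr.1]
      exact circleAverage_congr_sphere fun z hz => by simp only [hVf z (hsb hz)]
    · have hG : AnalyticOnNhd ℂ (fun z => z * deriv f z) (ball 0 R) :=
        analyticOnNhd_id.mul hf.deriv
      have hdG : DiffContOnCl ℂ (fun z => z * deriv f z) (ball 0 |r|) := by
        rw [abs_of_pos hr0]
        refine DifferentiableOn.diffContOnCl ?_
        rw [closure_ball _ hr0.ne']
        exact hG.differentiableOn.mono (closedBall_subset_ball hr.2)
      have h0 := congrArg Complex.re hdG.circleAverage
      rw [← Complex.reCLM_apply, ← Complex.reCLM.circleAverage_comp_comm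
        (hG.continuousOn.mono hsb).circleIntegrable'] at h0
      simp only [zero_mul, Complex.zero_re] at h0
      rw [← h0]
      exact circleAverage_congr_sphere fun z hz => hVf z (hsb hz)
  have hpos : ∀ r ∈ Ioc ‖z₀‖ R, 0 ≤ r := fun r hr => (norm_nonneg _).trans hr.1.le
  constructor
  -- The averages are continuous in r up to r = R, because the singularity z₀ lies off the annulus
  -- |z₀| < |z| ≤ R.
  · have := ((continuousOn_log_norm_sub_mul hV).circleAverage hpos).eq_of_eqOn_Ioo hz₀
      fun r hr => (hrad r hr).1
    rw [this]
    ring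
  · refine ContinuousOn.eq_of_eqOn_Ioo (ContinuousOn.circleAverage (hV.mono fun z hz => ?_) hpos)
      hz₀ fun r hr => (hrad r hr).2
    simpa using hz.2

end DiscNeumann

/-! ### Second derivatives along curves and lines -/

section SecondDerivatives

variable {E : Type*} [NormedAddCommGroup E] [NormedSpace ℝ E]

/-- The chain rule applied twice. The acceleration term survives for the curved coordinate lines of
the stereographic chart. -/
theorem ContDiffAt.hasDerivAt_fderiv_comp_curve {W : E → ℝ} {γ γ' : ℝ → E} {γ'' : E} {t : ℝ}
    (hW : ContDiffAt ℝ 2 W (γ t)) (hγ : HasDerivAt γ (γ' t) t) (hγ' : HasDerivAt γ' γ'' t) :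
    HasDerivAt (fun s => fderiv ℝ W (γ s) (γ' s))
      (iteratedFDeriv ℝ 2 W (γ t) ![γ' t, γ' t] + fderiv ℝ W (γ t) γ'') t := by
  have h1 : DifferentiableAt ℝ (fderiv ℝ W) (γ t) :=
    (hW.fderiv_right (m := 1) le_rfl).differentiableAt one_ne_zero
  have h2 := (h1.hasFDerivAt.comp_hasDerivAt t hγ).clm_apply hγ'
  rw [iteratedFDeriv_two_apply]
  exact h2

theorem ContDiffAt.eventually_hasDerivAt_comp_curve {W : E → ℝ} {γ γ' : ℝ → E} {t : ℝ}
    (hW : ContDiffAt ℝ 2 W (γ t)) (hγ : ∀ᶠ s in 𝓝 t, HasDerivAt γ (γ' s) s) :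
    ∀ᶠ s in 𝓝 t, HasDerivAt (fun s => W (γ s)) (fderiv ℝ W (γ s) (γ' s)) s := by
  have h1 := (hγ.self_of_nhds).continuousAt.eventually (hW.eventually (by simp))
  filter_upwards [h1, hγ] with s hs hs'
  exact (hs.differentiableAt two_ne_zero).hasFDerivAt.comp_hasDerivAt s hs'

/-- Reduces a diagonal second derivative to one-variable calculus; a Laplacian needs only diagonal
values. -/
theorem ContDiffAt.iteratedFDeriv_two_eq_of_line {f : E → ℝ} {x v : E} {φ' : ℝ → ℝ} {d : ℝ}
    (hf : ContDiffAt ℝ 2 f x) (h1 : ∀ᶠ t in 𝓝 (0 : ℝ), HasDerivAt (fun t => f (x + t • v)) (φ' t) t)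
    (h2 : HasDerivAt φ' d 0) : iteratedFDeriv ℝ 2 f x ![v, v] = d := by
  have hγ : ∀ t : ℝ, HasDerivAt (fun t : ℝ => x + t • v) v t := fun t => by
    simpa using ((hasDerivAt_id t).smul_const v).const_add x
  have hf' : ContDiffAt ℝ 2 f (x + (0 : ℝ) • v) := by simpa using hf
  have e1 := hf'.eventually_hasDerivAt_comp_curve (γ := fun t => x + t • v) (γ' := fun _ => v)
    (Eventually.of_forall hγ)
  have e2 := hf'.hasDerivAt_fderiv_comp_curve (γ := fun t => x + t • v) (γ' := fun _ => v) (hγ 0)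
    (hasDerivAt_const _ _)
  have e3 : (fun t : ℝ => fderiv ℝ f (x + t • v) v) =ᶠ[𝓝 0] φ' := by
    filter_upwards [e1, h1] with t ht ht'
    exact ht.unique ht'
  simpa using (e2.congr_of_eventuallyEq e3.symm).unique h2

end SecondDerivatives

/-! ### Radially constant extensions and their vanishing radial derivatives -/

section RadialExtension

theorem radialExt_smul (F : E3 → ℝ) {c : ℝ} (hc : 0 < c) (x : E3) :
    radialExt F (c • x) = radialExt F x := by
  unfold radialExt
  rw [norm_smul, Real.norm_of_nonneg hc.le, smul_smul, mul_inv_rev, mul_assoc,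
    inv_mul_cancel₀ hc.ne', mul_one]

theorem radialExt_of_norm_one (F : E3 → ℝ) {x : E3} (hx : ‖x‖ = 1) : radialExt F x = F x := by
  simp [radialExt, hx]

theorem eventually_radialExt_line (F : E3 → ℝ) (x : E3) :
    ∀ᶠ t in 𝓝 (0 : ℝ), radialExt F (x + t • x) = radialExt F x := by
  filter_upwards [Ioi_mem_nhds (show (-1 : ℝ) < 0 by norm_num)] with t ht
  rw [← radialExt_smul F (show 0 < 1 + t by linarith [mem_Ioi.1 ht]) x, add_smul, one_smul]

theorem fderiv_radialExt_self (F : E3 → ℝ) {x : E3} (hF : DifferentiableAt ℝ (radialExt F) x) :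
    fderiv ℝ (radialExt F) x x = 0 := by
  have hγ : HasDerivAt (fun t : ℝ => x + t • x) x 0 := by
    simpa using ((hasDerivAt_id (0 : ℝ)).smul_const x).const_add x
  have hF' : DifferentiableAt ℝ (radialExt F) (x + (0 : ℝ) • x) := by simpa using hF
  have h1 := hF'.hasFDerivAt.comp_hasDerivAt 0 hγ
  have h2 := (hasDerivAt_const (0 : ℝ) (radialExt F x)).congr_of_eventuallyEq
    (eventually_radialExt_line F x)
  simpa using h1.unique h2

theorem iteratedFDeriv_two_radialExt_self (F : E3 → ℝ) {x : E3}
    (hF : ContDiffAt ℝ 2 (radialExt F) x) :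
    iteratedFDeriv ℝ 2 (radialExt F) x ![x, x] = 0 := by
  refine hF.iteratedFDeriv_two_eq_of_line (φ' := fun _ => 0) ?_ (hasDerivAt_const _ _)
  filter_upwards [(eventually_radialExt_line F x).eventually_nhds] with t ht
  exact (hasDerivAt_const t (radialExt F x)).congr_of_eventuallyEq ht

end RadialExtension

/-! ### Stereographic projection and conformal invariance of the Laplacian -/

section Stereographic

/-- The linear combination of three vectors. -/
noncomputable def frame (u v w : E3) (α β γ : ℝ) : E3 := α • u + β • v + γ • w

theorem inner_frame {u v w : E3} (h : Orthonormal ℝ ![u, v, w]) (α β γ α' β' γ' : ℝ) :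
    ⟪frame u v w α β γ, frame u v w α' β' γ'⟫ = α * α' + β * β' + γ * γ' := by
  have h' := orthonormal_iff_ite.1 h
  have huv := h' 0 1
  have huw := h' 0 2
  have hvw := h' 1 2
  have huu : ‖u‖ = 1 := h.1 0
  have hvv : ‖v‖ = 1 := h.1 1
  have hww : ‖w‖ = 1 := h.1 2
  simp at huv huw hvw
  have hvu := huv
  have hwu := huw
  have hwv := hvw
  rw [real_inner_comm] at hvu hwu hwv
  simp [frame, inner_add_left, inner_add_right, inner_smul_left, inner_smul_right, *]
  ring

theorem frame_one (u v w : E3) : frame u v w 1 0 0 = u := by simp [frame]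

theorem norm_sq_frame {u v w : E3} (h : Orthonormal ℝ ![u, v, w]) (α β γ : ℝ) :
    ‖frame u v w α β γ‖ ^ 2 = α ^ 2 + β ^ 2 + γ ^ 2 := by
  rw [← real_inner_self_eq_norm_sq, inner_frame h]; ring

theorem hasDerivAt_frame (u v w : E3) {f g h : ℝ → ℝ} {f' g' h' t : ℝ} (hf : HasDerivAt f f' t)
    (hg : HasDerivAt g g' t) (hh : HasDerivAt h h' t) :
    HasDerivAt (fun s => frame u v w (f s) (g s) (h s)) (frame u v w f' g' h') t :=
  ((hf.smul_const u).add (hg.smul_const v)).add (hh.smul_const w)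

/-- Inverse stereographic projection onto the unit sphere, with `u` the image of the origin. -/
noncomputable def stereo (u v w : E3) (x y : ℝ) : E3 :=
  frame u v w ((1 - x ^ 2 - y ^ 2) / (1 + x ^ 2 + y ^ 2)) (2 * x / (1 + x ^ 2 + y ^ 2))
    (2 * y / (1 + x ^ 2 + y ^ 2))

/-- The partial derivative of `stereo` in the first variable. -/
noncomputable def stereoDx (u v w : E3) (x y : ℝ) : E3 :=
  frame u v w (-(4 * x) / (1 + x ^ 2 + y ^ 2) ^ 2)
    (2 / (1 + x ^ 2 + y ^ 2) - 4 * x ^ 2 / (1 + x ^ 2 + y ^ 2) ^ 2)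
    (-(4 * x * y) / (1 + x ^ 2 + y ^ 2) ^ 2)

/-- The second partial derivative of `stereo` in the first variable. -/
noncomputable def stereoDxx (u v w : E3) (x y : ℝ) : E3 :=
  frame u v w (-4 / (1 + x ^ 2 + y ^ 2) ^ 2 + 16 * x ^ 2 / (1 + x ^ 2 + y ^ 2) ^ 3)
    (-(12 * x) / (1 + x ^ 2 + y ^ 2) ^ 2 + 16 * x ^ 3 / (1 + x ^ 2 + y ^ 2) ^ 3)
    (-(4 * y) / (1 + x ^ 2 + y ^ 2) ^ 2 + 16 * x ^ 2 * y / (1 + x ^ 2 + y ^ 2) ^ 3)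

/-- By this symmetry the y-derivatives are the x-derivatives with v, w and x, y exchanged, so only
one set is computed. -/
theorem stereo_swap (u v w : E3) (x y : ℝ) : stereo u v w x y = stereo u w v y x := by
  have : 1 + x ^ 2 + y ^ 2 = 1 + y ^ 2 + x ^ 2 := by ring
  simp only [stereo, frame, this]
  rw [show 1 - x ^ 2 - y ^ 2 = 1 - y ^ 2 - x ^ 2 by ring]
  abel

theorem one_add_sq_add_sq_pos (x y : ℝ) : 0 < 1 + x ^ 2 + y ^ 2 := by positivity

theorem hasDerivAt_stereo (u v w : E3) (x y : ℝ) :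
    HasDerivAt (fun s => stereo u v w s y) (stereoDx u v w x y) x := by
  have hq := (one_add_sq_add_sq_pos x y).ne'
  have hx := hasDerivAt_id' x
  have h2 : HasDerivAt (fun s : ℝ => s ^ 2) (2 * x) x := by simpa using hx.fun_pow 2
  have d : HasDerivAt (fun s : ℝ => 1 + s ^ 2 + y ^ 2) (2 * x) x := (h2.const_add 1).add_const _
  refine hasDerivAt_frame u v w ?_ ?_ ?_
  · refine ((((h2.const_sub 1).sub_const _).fun_div d hq)).congr_deriv ?_
    field_simp
    ring
  · refine ((hx.const_mul 2).fun_div d hq).congr_deriv ?_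
    field_simp
    ring
  · refine ((hasDerivAt_const x (2 * y)).fun_div d hq).congr_deriv ?_
    field_simp
    ring

theorem hasDerivAt_stereoDx (u v w : E3) (x y : ℝ) :
    HasDerivAt (fun s => stereoDx u v w s y) (stereoDxx u v w x y) x := by
  have hq := (one_add_sq_add_sq_pos x y).ne'
  have hq2 := pow_ne_zero 2 hq
  have hx := hasDerivAt_id' x
  have h2 : HasDerivAt (fun s : ℝ => s ^ 2) (2 * x) x := by simpa using hx.fun_pow 2
  have d : HasDerivAt (fun s : ℝ => 1 + s ^ 2 + y ^ 2) (2 * x) x := (h2.const_add 1).add_const _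
  have d2 := d.fun_pow 2
  refine hasDerivAt_frame u v w ?_ ?_ ?_
  · refine (((hx.const_mul 4).fun_neg).fun_div d2 hq2).congr_deriv ?_
    field_simp
    ring
  · refine (((hasDerivAt_const x (2 : ℝ)).fun_div d hq).fun_sub
      ((h2.const_mul 4).fun_div d2 hq2)).congr_deriv ?_
    field_simp
    ring
  · refine ((((hx.const_mul 4).mul_const y).fun_neg).fun_div d2 hq2).congr_deriv ?_
    field_simp
    ring

theorem norm_stereo {u v w : E3} (h : Orthonormal ℝ ![u, v, w]) (x y : ℝ) :
    ‖stereo u v w x y‖ = 1 := by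
  have hq := (one_add_sq_add_sq_pos x y).ne'
  have : ‖stereo u v w x y‖ ^ 2 = 1 := by
    rw [stereo, norm_sq_frame h]
    field_simp
    ring
  nlinarith [norm_nonneg (stereo u v w x y)]

theorem contDiff_stereo (u v w : E3) :
    ContDiff ℝ 2 (fun z : ℂ => stereo u v w z.re z.im) := by
  have hre : ContDiff ℝ 2 (fun z : ℂ => z.re) := Complex.reCLM.contDiff
  have him : ContDiff ℝ 2 (fun z : ℂ => z.im) := Complex.imCLM.contDiff
  have hq : ContDiff ℝ 2 (fun z : ℂ => 1 + z.re ^ 2 + z.im ^ 2) :=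
    (contDiff_const.add (hre.pow 2)).add (him.pow 2)
  have hq0 : ∀ z : ℂ, 1 + z.re ^ 2 + z.im ^ 2 ≠ 0 := fun z =>
    (one_add_sq_add_sq_pos z.re z.im).ne'
  exact (((((contDiff_const.sub (hre.pow 2)).sub (him.pow 2)).div hq hq0).smul contDiff_const).add
    (((contDiff_const.mul hre).div hq hq0).smul contDiff_const)).add
    (((contDiff_const.mul him).div hq hq0).smul contDiff_const)

/-- The conformal frame of the stereographic projection. -/
theorem orthonormal_stereo {u v w : E3} (h : Orthonormal ℝ ![u, v, w])
    (x y : ℝ) : Orthonormal ℝ ![((1 + x ^ 2 + y ^ 2) / 2) • stereoDx u v w x y,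
      ((1 + x ^ 2 + y ^ 2) / 2) • stereoDx u w v y x, stereo u v w x y] := by
  have hq := (one_add_sq_add_sq_pos x y).ne'
  have hsw : ∀ α β γ, frame u w v α β γ = frame u v w α γ β := fun α β γ => by
    simp only [frame]; abel
  have e : 1 + y ^ 2 + x ^ 2 = 1 + x ^ 2 + y ^ 2 := by ring
  have h11 : ⟪stereoDx u v w x y, stereoDx u v w x y⟫ = 4 / (1 + x ^ 2 + y ^ 2) ^ 2 := by
    simp only [stereoDx, inner_frame h]
    field_simp
    ring
  have h22 : ⟪stereoDx u w v y x, stereoDx u w v y x⟫ = 4 / (1 + x ^ 2 + y ^ 2) ^ 2 := by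
    simp only [stereoDx, hsw, e, inner_frame h]
    field_simp
    ring
  have h12 : ⟪stereoDx u v w x y, stereoDx u w v y x⟫ = 0 := by
    simp only [stereoDx, hsw, e, inner_frame h]
    field_simp
    ring
  have h13 : ⟪stereoDx u v w x y, stereo u v w x y⟫ = 0 := by
    simp only [stereoDx, stereo, inner_frame h]
    field_simp
    ring
  have h23 : ⟪stereoDx u w v y x, stereo u v w x y⟫ = 0 := by
    simp only [stereoDx, stereo, hsw, e, inner_frame h]
    field_simp
    ring
  have h33 : ⟪stereo u v w x y, stereo u v w x y⟫ = 1 := by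
    rw [real_inner_self_eq_norm_sq, norm_stereo h]; norm_num
  have h21 := h12
  have h31 := h13
  have h32 := h23
  rw [real_inner_comm] at h21 h31 h32
  rw [orthonormal_iff_ite]
  intro i j
  fin_cases i <;> fin_cases j <;>
    simp [inner_smul_left, inner_smul_right, h11, h22, h33, h12, h13, h23, h21, h31, h32,
      -inner_self_eq_norm_sq_to_K]
  all_goals field_simp
  all_goals norm_num

/-- The coordinate Laplacian of the embedding is normal to the sphere: it is -2 times the conformal
factor 4/(1+|z|²)² times the position vector. First-order terms therefore fall in the radial
direction. -/
theorem stereoDxx_add (u v w : E3) (x y : ℝ) : stereoDxx u v w x y + stereoDxx u w v y x =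
    (-8 / (1 + x ^ 2 + y ^ 2) ^ 2) • stereo u v w x y := by
  have hq := (one_add_sq_add_sq_pos x y).ne'
  have e : 1 + y ^ 2 + x ^ 2 = 1 + x ^ 2 + y ^ 2 := by ring
  simp only [stereoDxx, stereo, frame, e]
  match_scalars
  all_goals field_simp
  all_goals ring

/-- Conformal invariance: the Laplacian of a function in stereographic coordinates. -/
theorem laplacian_comp_stereo {u v w : E3} (h : Orthonormal ℝ ![u, v, w]) (F : E3 → ℝ) (z : ℂ)
    (hF : ContDiffAt ℝ 2 (radialExt F) (stereo u v w z.re z.im)) :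
    Laplacian.laplacian (fun z : ℂ => radialExt F (stereo u v w z.re z.im)) z =
      4 / (1 + z.re ^ 2 + z.im ^ 2) ^ 2 * beltrami F (stereo u v w z.re z.im) := by
  set W := radialExt F with hW
  set n := stereo u v w z.re z.im with hn
  have hcomp : ContDiffAt ℝ 2 (fun z : ℂ => W (stereo u v w z.re z.im)) z :=
    ContDiffAt.comp (g := W) z hF (contDiff_stereo u v w).contDiffAt
  rw [InnerProductSpace.laplacian_eq_iteratedFDeriv_complexPlane]
  have hF' : ContDiffAt ℝ 2 W (stereo u w v z.im z.re) := by rwa [← stereo_swap]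
  have d1 : iteratedFDeriv ℝ 2 (fun z : ℂ => W (stereo u v w z.re z.im)) z ![1, 1] =
      iteratedFDeriv ℝ 2 W n ![stereoDx u v w z.re z.im, stereoDx u v w z.re z.im] +
        fderiv ℝ W n (stereoDxx u v w z.re z.im) := by
    have k1 : ∀ t : ℝ, HasDerivAt (fun t => stereo u v w (z.re + t) z.im)
        (stereoDx u v w (z.re + t) z.im) t := fun t =>
      (hasDerivAt_stereo u v w (z.re + t) z.im).comp_const_add z.re t
    have k2 : HasDerivAt (fun t => stereoDx u v w (z.re + t) z.im)
        (stereoDxx u v w (z.re + 0) z.im) 0 :=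
      (hasDerivAt_stereoDx u v w (z.re + 0) z.im).comp_const_add z.re 0
    have hF0 : ContDiffAt ℝ 2 W (stereo u v w (z.re + 0) z.im) := by simpa using hF
    have e1 := hF0.eventually_hasDerivAt_comp_curve (γ := fun t => stereo u v w (z.re + t) z.im)
      (Eventually.of_forall k1)
    have e2 := hF0.hasDerivAt_fderiv_comp_curve (γ := fun t => stereo u v w (z.re + t) z.im)
      (k1 0) k2
    simp only [add_zero] at e2
    refine hcomp.iteratedFDeriv_two_eq_of_line ?_ e2
    simpa using e1
  have d2 : iteratedFDeriv ℝ 2 (fun z : ℂ => W (stereo u v w z.re z.im)) z ![Complex.I, Complex.I] =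
      iteratedFDeriv ℝ 2 W n ![stereoDx u w v z.im z.re, stereoDx u w v z.im z.re] +
        fderiv ℝ W n (stereoDxx u w v z.im z.re) := by
    have k1 : ∀ t : ℝ, HasDerivAt (fun t => stereo u w v (z.im + t) z.re)
        (stereoDx u w v (z.im + t) z.re) t := fun t =>
      (hasDerivAt_stereo u w v (z.im + t) z.re).comp_const_add z.im t
    have k2 : HasDerivAt (fun t => stereoDx u w v (z.im + t) z.re)
        (stereoDxx u w v (z.im + 0) z.re) 0 :=
      (hasDerivAt_stereoDx u w v (z.im + 0) z.re).comp_const_add z.im 0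
    have hF0 : ContDiffAt ℝ 2 W (stereo u w v (z.im + 0) z.re) := by simpa using hF'
    have e1 := hF0.eventually_hasDerivAt_comp_curve (γ := fun t => stereo u w v (z.im + t) z.re)
      (Eventually.of_forall k1)
    have e2 := hF0.hasDerivAt_fderiv_comp_curve (γ := fun t => stereo u w v (z.im + t) z.re)
      (k1 0) k2
    simp only [add_zero] at e2
    rw [← stereo_swap] at e2
    refine hcomp.iteratedFDeriv_two_eq_of_line ?_ e2
    simpa [stereo_swap u v w] using e1
  have hb := orthonormal_stereo h z.re z.im
  have hcard : Fintype.card (Fin 3) = Module.finrank ℝ E3 := by simp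
  set B := (basisOfOrthonormalOfCardEqFinrank hb hcard).toOrthonormalBasis (by simpa using hb)
    with hB
  -- The trace is taken in the conformal frame: two normalised coordinate directions and the normal
  -- n, whose contribution vanishes by `hrad`.
  have hlap : beltrami F n = ∑ i, iteratedFDeriv ℝ 2 W n ![B i, B i] := by
    rw [beltrami, InnerProductSpace.laplacian_eq_iteratedFDeriv_orthonormalBasis _ B]
  have hBi : ∀ i, B i = ![((1 + z.re ^ 2 + z.im ^ 2) / 2) • stereoDx u v w z.re z.im,
      ((1 + z.re ^ 2 + z.im ^ 2) / 2) • stereoDx u w v z.im z.re, n] i := fun i => by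
    simp [hB, hn]
  have hsm : ∀ (c : ℝ) (x : E3), iteratedFDeriv ℝ 2 W n ![c • x, c • x] =
      c ^ 2 * iteratedFDeriv ℝ 2 W n ![x, x] := fun c x => by
    simp only [iteratedFDeriv_two_apply]
    simp
    ring
  have hrad := iteratedFDeriv_two_radialExt_self F hF
  have hsum := fderiv_radialExt_self F (hF.differentiableAt two_ne_zero)
  -- The two acceleration terms add up to a multiple of the radial derivative of W, which is zero.
  have hdd : fderiv ℝ W n (stereoDxx u v w z.re z.im) + fderiv ℝ W n (stereoDxx u w v z.im z.re)
      = 0 := by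
    rw [← map_add, stereoDxx_add, map_smul, hsum, smul_zero]
  simp only [Fin.sum_univ_three, hBi] at hlap
  simp only [Matrix.cons_val_zero, Matrix.cons_val_one, Matrix.cons_val, hsm] at hlap
  rw [hrad] at hlap
  have hq := (one_add_sq_add_sq_pos z.re z.im).ne'
  simp only [d1, d2, hlap]
  field_simp
  linear_combination 4 * (1 + z.re ^ 2 + z.im ^ 2) ^ 2 * hdd

end Stereographic

/-! ### One-dimensional Hausdorff measure on a circle -/

section CircleArcLength

open scoped NNReal ENNReal
open Measure

theorem norm_circleMap_sub_circleMap (R s t : ℝ) :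
    ‖circleMap 0 R s - circleMap 0 R t‖ = |R| * (2 * |sin ((s - t) / 2)|) := by
  have : circleMap 0 R s - circleMap 0 R t =
      R * Complex.exp (t * Complex.I) * (Complex.exp (Complex.I * ((s - t : ℝ) : ℂ)) - 1) := by
    rw [mul_sub, mul_assoc, ← Complex.exp_add]
    simp only [circleMap, zero_add, mul_one]
    congr 3
    push_cast
    ring
  rw [this, norm_mul, norm_mul, Complex.norm_exp_ofReal_mul_I, Complex.norm_exp_I_mul_ofReal_sub_one,
    Complex.norm_real]
  simp

/-- The chord over an angle x is 2R sin(x/2). The cubic lower bound for the sine makes it at least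
R(1 - δ)x when x ≤ δ ≤ 1, and R(1 - δ) ≥ c. -/
theorem mul_abs_sub_le_norm_circleMap_sub {R c δ : ℝ} (hR : 0 < R) (hδ1 : δ ≤ 1)
    (hδ : R * δ ≤ R - c) {s t : ℝ} (hst : |s - t| ≤ δ) :
    c * |s - t| ≤ ‖circleMap 0 R s - circleMap 0 R t‖ := by
  rw [norm_circleMap_sub_circleMap, abs_of_pos hR]
  set x := |s - t| with hx
  have hx0 : 0 ≤ x := abs_nonneg _
  have hsin : |sin ((s - t) / 2)| = sin (x / 2) := by
    have hpos : 0 ≤ sin (x / 2) :=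
      sin_nonneg_of_nonneg_of_le_pi (by positivity) (by linarith [pi_gt_three])
    rw [← abs_of_nonneg hpos]
    rcases abs_cases (s - t) with ⟨h, _⟩ | ⟨h, _⟩
    · rw [hx, h]
    · rw [hx, h, neg_div, sin_neg, abs_neg]
  rw [hsin]
  rcases hx0.eq_or_lt with h | h
  · rw [← h]; simp
  have h3 := sin_gt_sub_cube (x := x / 2) (by positivity)
  have h4 : x - x * δ ≤ 2 * sin (x / 2) := by
    have : x ^ 3 ≤ x * δ := by
      have : x ^ 2 ≤ δ := by nlinarith
      nlinarith
    nlinarith [mul_nonneg hx0 (hx0.trans hst)]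
  calc c * x ≤ (R - R * δ) * x := by gcongr; linarith
    _ = R * (x - x * δ) := by ring
    _ ≤ _ := by gcongr

theorem mul_volume_le_hausdorffMeasure_circleMap_image_of_small {R c δ : ℝ} (hR : 0 < R)
    (hc : 0 < c) (hδ1 : δ ≤ 1) (hδ : R * δ ≤ R - c) {S : Set ℝ}
    (hS : ∀ s ∈ S, ∀ t ∈ S, |s - t| ≤ δ) :
    ENNReal.ofReal c * volume S ≤ μH[1] (circleMap 0 R '' S) := by
  have hanti : AntilipschitzWith ⟨c⁻¹, (inv_pos.2 hc).le⟩ (fun s : S => circleMap 0 R s) := by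
    refine AntilipschitzWith.of_le_mul_dist fun s t => ?_
    have := mul_abs_sub_le_norm_circleMap_sub hR hδ1 hδ (hS s s.2 t t.2)
    rw [Subtype.dist_eq, Real.dist_eq, dist_eq_norm]
    change _ ≤ c⁻¹ * _
    rwa [le_inv_mul_iff₀ hc]
  have h1 := hanti.le_hausdorffMeasure_image (d := 1) zero_le_one univ
  have h2 : μH[1] (univ : Set S) = volume S := by
    rw [← isometry_subtype_coe.hausdorffMeasure_image (Or.inl zero_le_one), hausdorffMeasure_real]
    simp
  have h3 : (fun s : S => circleMap 0 R s) '' univ = circleMap 0 R '' S := by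
    ext; simp
  rw [h2, h3, ENNReal.rpow_one] at h1
  calc ENNReal.ofReal c * volume S ≤ ENNReal.ofReal c * ((NNReal.mk c⁻¹ (inv_pos.2 hc).le : ℝ≥0) * μH[1] (circleMap 0 R '' S)) := by
        gcongr
        exact h1
    _ = μH[1] (circleMap 0 R '' S) := by
      rw [← mul_assoc]
      have : (((NNReal.mk c⁻¹ (inv_pos.2 hc).le) : ℝ≥0) : ℝ≥0∞) = ENNReal.ofReal c⁻¹ := by
        rw [ENNReal.ofReal, Real.toNNReal_of_nonneg (inv_pos.2 hc).le]
      rw [this, ← ENNReal.ofReal_mul hc.le, mul_inv_cancel₀ hc.ne', ENNReal.ofReal_one, one_mul]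

theorem injOn_circleMap_Ioc {R : ℝ} (hR : 0 < R) : (Ioc 0 (2 * π)).InjOn (circleMap 0 R) := by
  have := injOn_circleMap_of_abs_sub_le (a := 0) (b := 2 * π) (c := 0) hR.ne'
    (by rw [zero_sub, abs_neg, abs_of_pos two_pi_pos])
  rwa [uIoc_of_le two_pi_pos.le] at this

/-- The arc length of subsets of a circle. -/
theorem hausdorffMeasure_circleMap_image {R : ℝ} (hR : 0 < R) {S : Set ℝ} (hS : MeasurableSet S)
    (hS' : S ⊆ Ioc 0 (2 * π)) :
    μH[1] (circleMap 0 R '' S) = ENNReal.ofReal R * volume S := by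
  -- The upper bound is the Lipschitz constant R. For the lower bound with any c < R, S is cut into
  -- pieces of length δ on which chords are at least c times angles; injectivity keeps the images
  -- disjoint, so the bounds add up.
  refine le_antisymm ?_ (ENNReal.mul_le_of_forall_lt fun c' hc' v hv => ?_)
  · have h := (lipschitzWith_circleMap 0 R).hausdorffMeasure_image_le (d := 1) zero_le_one S
    rw [hausdorffMeasure_real, ENNReal.rpow_one] at h
    refine h.trans_eq ?_
    congr 1
    rw [ENNReal.ofReal, ← Real.nnabs_of_nonneg hR.le]
  · refine (mul_le_mul' le_rfl hv.le).trans ?_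
    obtain ⟨c, rfl⟩ : ∃ c : ℝ≥0, (c : ℝ≥0∞) = c' := ⟨c'.toNNReal, ENNReal.coe_toNNReal (by
      exact ne_top_of_lt hc')⟩
    rcases eq_or_ne c 0 with rfl | hc0
    · simp
    have hcpos : 0 < (c : ℝ) := by positivity
    have hcR : (c : ℝ) < R := by
      rw [← ENNReal.ofReal_coe_nnreal] at hc'
      exact (ENNReal.ofReal_lt_ofReal_iff hR).1 hc'
    -- The second entry is exactly the condition R(1 - δ) ≥ c.
    set δ : ℝ := min 1 ((R - c) / R) with hδdef
    have hδ0 : 0 < δ := lt_min one_pos (div_pos (sub_pos.2 hcR) hR)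
    have hδ1 : δ ≤ 1 := min_le_left _ _
    have hδ : R * δ ≤ R - c := by
      have := min_le_right 1 ((R - c) / R)
      rwa [← hδdef, le_div_iff₀' hR] at this
    set T : ℤ → Set ℝ := fun n => S ∩ Ioc (n • δ) ((n + 1) • δ) with hT
    have hTS : S = ⋃ n, T n := by
      rw [hT, ← inter_iUnion, iUnion_Ioc_zsmul hδ0, inter_univ]
    have hTm : ∀ n, MeasurableSet (T n) := fun n => hS.inter measurableSet_Ioc
    have hTd : Pairwise (Function.onFun Disjoint T) := fun m n hmn =>
      (pairwise_disjoint_Ioc_zsmul δ hmn).mono inter_subset_right inter_subset_right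
    have hinj := (injOn_circleMap_Ioc hR).mono hS'
    have hTsub : ∀ n, T n ⊆ S := fun n => inter_subset_left
    have hTi : ∀ n, MeasurableSet (circleMap 0 R '' T n) := fun n =>
      (hTm n).image_of_continuousOn_injOn (continuous_circleMap 0 R).continuousOn
        (hinj.mono (hTsub n))
    have hTid : Pairwise (Function.onFun Disjoint fun n => circleMap 0 R '' T n) :=
      fun m n hmn => by
        have := hTd hmn
        rw [Function.onFun, disjoint_iff_inter_eq_empty] at this ⊢
        rw [← hinj.image_inter (hTsub m) (hTsub n), this, image_empty]
    have e1 : volume S = ∑' n, volume (T n) := by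
      conv_lhs => rw [hTS]
      exact measure_iUnion hTd hTm
    have e2 : μH[1] (circleMap 0 R '' S) = ∑' n, μH[1] (circleMap 0 R '' T n) := by
      conv_lhs => rw [hTS, image_iUnion]
      exact measure_iUnion hTid hTi
    rw [e1, e2, ← ENNReal.tsum_mul_left]
    refine ENNReal.tsum_le_tsum fun n => ?_
    rw [← ENNReal.ofReal_coe_nnreal]
    refine mul_volume_le_hausdorffMeasure_circleMap_image_of_small hR hcpos hδ1 hδ ?_
    rintro s ⟨-, hs1, hs2⟩ t ⟨-, ht1, ht2⟩
    rw [add_smul, one_smul] at hs2 ht2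
    rw [abs_le]
    constructor <;> linarith

theorem circleMap_image_Ioc {R : ℝ} (hR : 0 < R) :
    circleMap 0 R '' Ioc 0 (2 * π) = Metric.sphere 0 R := by
  rw [image_circleMap_Ioc, abs_of_pos hR]

theorem hausdorffMeasure_restrict_circle {R : ℝ} (hR : 0 < R) :
    (μH[1] : Measure ℂ).restrict (Metric.sphere 0 R) =
      ENNReal.ofReal R • (volume.restrict (Ioc 0 (2 * π))).map (circleMap 0 R) := by
  ext A hA
  have hm := (continuous_circleMap 0 R).measurable
  rw [restrict_apply hA, Measure.smul_apply, map_apply hm hA, restrict_apply (hm hA), smul_eq_mul,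
    ← hausdorffMeasure_circleMap_image hR ((hm hA).inter measurableSet_Ioc) inter_subset_right,
    image_preimage_inter, circleMap_image_Ioc hR]

/-- The line integral over the isometric image of a circle. -/
theorem integral_hausdorffMeasure_image_circle {R : ℝ} (hR : 0 < R) {J : ℂ → E3} (hJ : Isometry J)
    {g : E3 → ℝ} (hg : ContinuousOn g (J '' Metric.sphere 0 R)) :
    ∫ η in J '' Metric.sphere 0 R, g η ∂lineMeasure =
      2 * π * R * circleAverage (fun z => g (J z)) 0 R := by
  have hme : MeasurableEmbedding J := hJ.isClosedEmbedding.measurableEmbedding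
  have hmap : lineMeasure.restrict (J '' Metric.sphere 0 R) =
      ((μH[1] : Measure ℂ).restrict (Metric.sphere 0 R)).map J := by
    have := hme.restrict_map (μH[1] : Measure ℂ) (J '' Metric.sphere 0 R)
    rw [hJ.map_hausdorffMeasure (Or.inl zero_le_one), restrict_restrict
      (hme.measurableSet_image.2 Metric.isClosed_sphere.measurableSet),
      inter_eq_left.2 (image_subset_range _ _), hJ.injective.preimage_image] at this
    exact this
  have hgJ : ContinuousOn (fun z => g (J z)) (Metric.sphere 0 R) :=
    hg.comp hJ.continuous.continuousOn (mapsTo_image _ _)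
  have hmeas : AEStronglyMeasurable (fun z => g (J z))
      ((volume.restrict (Ioc 0 (2 * π))).map (circleMap 0 R)) := by
    refine (hgJ.aestronglyMeasurable (μ := μH[1]) Metric.isClosed_sphere.measurableSet).mono_ac ?_
    rw [hausdorffMeasure_restrict_circle hR]
    exact absolutelyContinuous_smul (by simpa using hR)
  rw [hmap, hme.integral_map, hausdorffMeasure_restrict_circle hR, integral_smul_measure,
    integral_map (continuous_circleMap 0 R).aemeasurable hmeas, circleAverage,
    intervalIntegral.integral_of_le two_pi_pos.le, ENNReal.toReal_ofReal hR.le, smul_eq_mul,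
    smul_eq_mul]
  field_simp

end CircleArcLength

/-! ### Volume of a spherical sector -/

section CapArea

open scoped ENNReal

theorem lintegral_radial (G : ℝ → ℝ≥0∞) (hG : Measurable G) :
    ∫⁻ p : ℝ × ℝ, G (√(p.1 ^ 2 + p.2 ^ 2)) = ∫⁻ r in Ioi (0 : ℝ), ENNReal.ofReal (2 * π * r) * G r := by
  rw [← lintegral_comp_polarCoord_symm, polarCoord_target, Measure.volume_eq_prod,
    ← Measure.prod_restrict, lintegral_prod _ (by
      refine Measurable.aemeasurable ?_
      simp only [polarCoord_symm_apply]
      fun_prop)]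
  refine setLIntegral_congr_fun measurableSet_Ioi fun r hr => ?_
  have hr' : 0 < r := hr
  have : ∀ φ : ℝ, √((r * cos φ) ^ 2 + (r * sin φ) ^ 2) = r := fun φ => by
    rw [show (r * cos φ) ^ 2 + (r * sin φ) ^ 2 = r ^ 2 by nlinarith [sin_sq_add_cos_sq φ],
      sqrt_sq hr'.le]
  simp only [polarCoord_symm_apply, this, smul_eq_mul, lintegral_const, Measure.restrict_apply_univ,
    Real.volume_Ioo]
  rw [show π - -π = 2 * π by ring, mul_right_comm, mul_comm (2 * π), ENNReal.ofReal_mul hr'.le]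

/-- The volume of a spherical sector, in cylindrical coordinates. -/
theorem volume_sector_coord {a : ℝ} (ha : a ∈ Ioo (-1 : ℝ) 1) :
    volume {q : ℝ × ℝ × ℝ | 0 < q.1 ^ 2 + √(q.2.1 ^ 2 + q.2.2 ^ 2) ^ 2 ∧
      q.1 ^ 2 + √(q.2.1 ^ 2 + q.2.2 ^ 2) ^ 2 < 1 ∧
      a * √(q.1 ^ 2 + √(q.2.1 ^ 2 + q.2.2 ^ 2) ^ 2) < q.1} =
      ENNReal.ofReal (1 / 3) * ENNReal.ofReal (2 * π * (1 - a)) := by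
  set K : Set (ℝ × ℝ) := {p | 0 < p.1 ^ 2 + p.2 ^ 2 ∧ p.1 ^ 2 + p.2 ^ 2 < 1 ∧
    a * √(p.1 ^ 2 + p.2 ^ 2) < p.1} with hK
  have hnm : Measurable fun p : ℝ × ℝ => p.1 ^ 2 + p.2 ^ 2 := by fun_prop
  have hKm : MeasurableSet K :=
    (measurableSet_lt measurable_const hnm).inter ((measurableSet_lt hnm measurable_const).inter
      (measurableSet_lt (hnm.sqrt.const_mul a) measurable_fst))
  set f : ℝ × ℝ → ℝ≥0∞ := K.indicator 1 with hf
  have hfm : Measurable f := measurable_one.indicator hKm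
  set S : Set (ℝ × ℝ × ℝ) := {q | 0 < q.1 ^ 2 + √(q.2.1 ^ 2 + q.2.2 ^ 2) ^ 2 ∧
      q.1 ^ 2 + √(q.2.1 ^ 2 + q.2.2 ^ 2) ^ 2 < 1 ∧
      a * √(q.1 ^ 2 + √(q.2.1 ^ 2 + q.2.2 ^ 2) ^ 2) < q.1} with hS
  -- Rotational symmetry: S depends only on the height and the distance to the axis. The squared
  -- root is left unsimplified in the statement so that this is definitional.
  have hSpre : S = (fun q : ℝ × ℝ × ℝ => (q.1, √(q.2.1 ^ 2 + q.2.2 ^ 2))) ⁻¹' K := rfl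
  have hSm : MeasurableSet S := hSpre ▸ (by fun_prop : Measurable _) hKm
  have e1 : volume S = ∫⁻ h : ℝ, ∫⁻ p : ℝ × ℝ, f (h, √(p.1 ^ 2 + p.2 ^ 2)) := by
    rw [← lintegral_indicator_one hSm, Measure.volume_eq_prod,
      lintegral_prod _ (measurable_one.indicator hSm).aemeasurable]
    rfl
  -- Polar coordinates across the axis leave the meridian half-plane with weight 2πr.
  have e2 : volume S = ∫⁻ p : ℝ × ℝ, (univ ×ˢ Ioi 0).indicator
      (fun p => ENNReal.ofReal (2 * π * p.2) * f p) p := by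
    have hgm : Measurable ((univ ×ˢ Ioi 0).indicator
      (fun p : ℝ × ℝ => ENNReal.ofReal (2 * π * p.2) * f p)) :=
      Measurable.indicator (by fun_prop) (MeasurableSet.univ.prod measurableSet_Ioi)
    rw [e1, Measure.volume_eq_prod, lintegral_prod _ hgm.aemeasurable]
    refine lintegral_congr fun h => ?_
    rw [← Measure.volume_eq_prod, lintegral_radial (fun r => f (h, r)) (by fun_prop), ← lintegral_indicator measurableSet_Ioi]
    refine lintegral_congr fun r => ?_
    simp [indicator]
  have harc : 0 ≤ arccos a := arccos_nonneg a
  have harcpi : arccos a ≤ π := arccos_le_pi a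
  -- A second set of polar coordinates, now in the half-plane with height s cos φ and radius s sin
  -- φ, turns the sector into the box s < 1, φ < arccos a. The integral then splits into 1/3 and
  -- 2π(1 - a).
  have e3 : volume S = ∫⁻ p in Ioo (0 : ℝ) 1 ×ˢ Ioo 0 (arccos a),
      ENNReal.ofReal (p.1 ^ 2) * ENNReal.ofReal (2 * π * sin p.2) := by
    rw [e2, ← lintegral_comp_polarCoord_symm, polarCoord_target,
      ← lintegral_indicator (measurableSet_Ioi.prod measurableSet_Ioo),
      ← lintegral_indicator (measurableSet_Ioo.prod measurableSet_Ioo)]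
    refine lintegral_congr fun p => ?_
    obtain ⟨s, φ⟩ := p
    simp only [polarCoord_symm_apply, smul_eq_mul, hf, hK]
    by_cases hs : 0 < s
    swap
    · rw [indicator_of_notMem (by simp [hs]), indicator_of_notMem (by simp [hs])]
    by_cases hφ : φ ∈ Ioo (-π) π
    swap
    · rw [indicator_of_notMem (by simp only [mem_prod, not_and]; exact fun _ => hφ),
        indicator_of_notMem]
      simp only [mem_prod, not_and]
      exact fun _ h => hφ ⟨by linarith [h.1, pi_pos], by linarith [h.2]⟩
    have hsq : (s * cos φ) ^ 2 + (s * sin φ) ^ 2 = s ^ 2 := by nlinarith [sin_sq_add_cos_sq φ]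
    rw [indicator_of_mem (mk_mem_prod (mem_Ioi.2 hs) hφ)]
    by_cases hφ0 : 0 < φ
    swap
    · have : sin φ ≤ 0 := sin_nonpos_of_nonpos_of_neg_pi_le (not_lt.1 hφ0) hφ.1.le
      rw [indicator_of_notMem (a := (s * cos φ, s * sin φ)), mul_zero,
        indicator_of_notMem (by simp [hφ0])]
      simp only [mem_prod, mem_univ, true_and, mem_Ioi, not_lt]
      exact mul_nonpos_of_nonneg_of_nonpos hs.le this
    have hsin : 0 < sin φ := sin_pos_of_pos_of_lt_pi hφ0 hφ.2
    rw [indicator_of_mem (a := (s * cos φ, s * sin φ)) (by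
      simp only [mem_prod, mem_univ, true_and, mem_Ioi]; positivity)]
    have hcos : a < cos φ ↔ φ < arccos a := by
      rw [← strictAntiOn_cos.lt_iff_gt ⟨harc, harcpi⟩ ⟨hφ0.le, hφ.2.le⟩,
        cos_arccos ha.1.le ha.2.le]
    by_cases h : s < 1 ∧ φ < arccos a
    · rw [indicator_of_mem (a := (s * cos φ, s * sin φ)), indicator_of_mem (a := (s, φ))]
      · rw [Pi.one_apply, mul_one, ← ENNReal.ofReal_mul hs.le, ← ENNReal.ofReal_mul (sq_nonneg s)]
        congr 1
        ring
      · exact ⟨⟨hs, h.1⟩, hφ0, h.2⟩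
      · simp only [mem_ofPred_eq, hsq, sqrt_sq hs.le]
        refine ⟨by positivity, by nlinarith [h.1], ?_⟩
        rw [mul_comm]
        exact mul_lt_mul_of_pos_left (hcos.2 h.2) hs
    · rw [indicator_of_notMem (a := (s * cos φ, s * sin φ)), mul_zero, mul_zero,
        indicator_of_notMem (a := (s, φ))]
      · simp only [mem_prod, mem_Ioo]
        tauto
      · simp only [mem_ofPred_eq, hsq, sqrt_sq hs.le]
        rintro ⟨-, h1, h2⟩
        refine h ⟨by nlinarith, hcos.1 ?_⟩
        rw [mul_comm] at h2
        exact lt_of_mul_lt_mul_left h2 hs.le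
  rw [e3, Measure.volume_eq_prod, ← Measure.prod_restrict,
    lintegral_prod_mul (f := fun s : ℝ => ENNReal.ofReal (s ^ 2))
      (g := fun φ : ℝ => ENNReal.ofReal (2 * π * sin φ)) (by fun_prop) (by fun_prop)]
  congr 1
  · rw [← ofReal_integral_eq_lintegral_ofReal, ← integral_Ioc_eq_integral_Ioo,
      ← intervalIntegral.integral_of_le zero_le_one, integral_pow]
    · norm_num
    · exact ((continuous_pow 2).integrableOn_Icc (a := 0) (b := 1)).mono_set Ioo_subset_Icc_self
    · exact Eventually.of_forall fun s => sq_nonneg s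
  · rw [← ofReal_integral_eq_lintegral_ofReal, ← integral_Ioc_eq_integral_Ioo,
      ← intervalIntegral.integral_of_le harc, intervalIntegral.integral_const_mul, integral_sin,
      cos_arccos ha.1.le ha.2.le, cos_zero]
    · exact ((by fun_prop : Continuous fun φ : ℝ => 2 * π * sin φ).integrableOn_Icc
        (a := 0) (b := arccos a)).mono_set Ioo_subset_Icc_self
    · filter_upwards [ae_restrict_mem measurableSet_Ioo] with φ hφ
      have := sin_nonneg_of_nonneg_of_le_pi hφ.1.le (hφ.2.le.trans harcpi)
      simp only [Pi.zero_apply]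
      positivity

end CapArea

/-! ### Surface measure, its invariance, and the area of a cap -/

section CapMeasure

open scoped ENNReal Pointwise

theorem exists_orthonormal_frame {ζ : E3} (hζ : ‖ζ‖ = 1) :
    ∃ b : OrthonormalBasis (Fin 3) ℝ E3, b 0 = ζ := by
  have hv : Orthonormal ℝ (({0} : Set (Fin 3)).domRestrict (fun _ => ζ)) :=
    ⟨fun _ => hζ, fun i j hij => absurd (Subsingleton.elim i j) hij⟩
  obtain ⟨b, hb⟩ := hv.exists_orthonormalBasis_extension_of_card_eq (by simp)
  exact ⟨b, hb 0 rfl⟩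

/-- `toSphere` is the dimension times the volume of the cone over the set in the punctured unit
ball; hence the factor 3. -/
theorem surfaceMeasure_apply {A : Set E3} (hA : MeasurableSet A) :
    surfaceMeasure A = 3 * volume {x : E3 | 0 < ‖x‖ ∧ ‖x‖ < 1 ∧ ‖x‖⁻¹ • x ∈ A} := by
  rw [surfaceMeasure, Measure.map_apply measurable_subtype_coe hA,
    Measure.toSphere_apply' _ (measurable_subtype_coe hA)]
  congr 1
  · simp
  · congr 1
    ext x
    simp only [Set.mem_smul, mem_image, mem_preimage, mem_Ioo, mem_ofPred_eq]
    constructor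
    · rintro ⟨r, ⟨hr0, hr1⟩, y, ⟨y', hy', rfl⟩, rfl⟩
      have hy1 : ‖(y' : E3)‖ = 1 := mem_sphere_zero_iff_norm.1 y'.2
      rw [norm_smul, hy1, mul_one, norm_of_nonneg hr0.le, smul_smul, inv_mul_cancel₀ hr0.ne',
        one_smul]
      exact ⟨hr0, hr1, hy'⟩
    · rintro ⟨h0, h1, hx⟩
      refine ⟨‖x‖, ⟨h0, h1⟩, ‖x‖⁻¹ • x, ⟨⟨‖x‖⁻¹ • x, ?_⟩, hx, rfl⟩, ?_⟩
      · rw [mem_sphere_zero_iff_norm, norm_smul, norm_inv, norm_norm, inv_mul_cancel₀ h0.ne']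
      · rw [smul_smul, mul_inv_cancel₀ h0.ne', one_smul]

instance : IsFiniteMeasure surfaceMeasure := by
  unfold surfaceMeasure; infer_instance

theorem measurableSet_sphericalCap (ζ : E3) (ρ : ℝ) : MeasurableSet (sphericalCap ζ ρ) :=
  Metric.isClosed_sphere.measurableSet.inter
    (measurableSet_lt (f := fun η : E3 => 1 - ⟪ζ, η⟫) (by fun_prop) measurable_const)

theorem measurePreserving_coordinates (b : OrthonormalBasis (Fin 3) ℝ E3) :
    MeasurePreserving (fun x : E3 => (⟪b 0, x⟫, ⟪b 1, x⟫, ⟪b 2, x⟫)) volume volume := by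
  have h1 := b.measurePreserving_repr
  have h2 := PiLp.volume_preserving_ofLp (Fin 3)
  have h3 := volume_preserving_piFinSuccAbove (fun _ : Fin 3 => ℝ) 0
  have h4 := (MeasurePreserving.id (volume : Measure ℝ)).prod (volume_preserving_finTwoArrow ℝ)
  have h := h4.comp (h3.comp (h2.comp h1))
  have e : (fun x : E3 => (⟪b 0, x⟫, ⟪b 1, x⟫, ⟪b 2, x⟫)) =
      Prod.map id MeasurableEquiv.finTwoArrow ∘
        MeasurableEquiv.piFinSuccAbove (fun _ : Fin 3 => ℝ) 0 ∘ WithLp.ofLp ∘ b.repr := by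
    funext x
    simp only [← b.repr_apply_apply]
    rfl
  rw [e]
  exact h

theorem surfaceMeasure_sphericalCap {ζ : E3} (hζ : ‖ζ‖ = 1) {ρ : ℝ} (hρ : ρ ∈ Ioo (0 : ℝ) 2) :
    surfaceMeasure.real (sphericalCap ζ ρ) = 2 * π * ρ := by
  obtain ⟨b, rfl⟩ := exists_orthonormal_frame hζ
  have ha : 1 - ρ ∈ Ioo (-1 : ℝ) 1 := ⟨by linarith [hρ.2], by linarith [hρ.1]⟩
  have hvol : volume {x : E3 | 0 < ‖x‖ ∧ ‖x‖ < 1 ∧ ‖x‖⁻¹ • x ∈ sphericalCap (b 0) ρ} =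
      ENNReal.ofReal (1 / 3) * ENNReal.ofReal (2 * π * (1 - (1 - ρ))) := by
    rw [← volume_sector_coord ha, ← (measurePreserving_coordinates b).measure_preimage]
    · congr 1
      ext x
      have hn : ⟪b 0, x⟫ ^ 2 + √(⟪b 1, x⟫ ^ 2 + ⟪b 2, x⟫ ^ 2) ^ 2 = ‖x‖ ^ 2 := by
        rw [sq_sqrt (by positivity), ← b.sum_sq_norm_inner_right x, Fin.sum_univ_three]
        simp [add_assoc]
      simp only [mem_preimage, mem_ofPred_eq, hn, sqrt_sq (norm_nonneg x), sphericalCap, unitSphere,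
        mem_sphere_zero_iff_norm, inner_smul_right]
      constructor
      · rintro ⟨h0, h1, -, h3⟩
        refine ⟨by positivity, by nlinarith, ?_⟩
        have : 1 - ρ < ‖x‖⁻¹ * ⟪b 0, x⟫ := by linarith
        rwa [inv_mul_eq_div, lt_div_iff₀ h0] at this
      · rintro ⟨h0, h1, h2⟩
        have h0' : 0 < ‖x‖ := by
          rcases (norm_nonneg x).eq_or_lt with h | h
          · rw [← h] at h0; norm_num at h0
          · exact h
        refine ⟨h0', by nlinarith, ?_, ?_⟩
        · rw [norm_smul, norm_inv, norm_norm, inv_mul_cancel₀ h0'.ne']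
        · have : 1 - ρ < ‖x‖⁻¹ * ⟪b 0, x⟫ := by rwa [inv_mul_eq_div, lt_div_iff₀ h0']
          linarith
    · refine MeasurableSet.nullMeasurableSet ?_
      have hm : Measurable fun q : ℝ × ℝ × ℝ => q.1 ^ 2 + √(q.2.1 ^ 2 + q.2.2 ^ 2) ^ 2 := by
        fun_prop
      exact (measurableSet_lt measurable_const hm).inter ((measurableSet_lt hm measurable_const).inter
        (measurableSet_lt (hm.sqrt.const_mul _) measurable_fst))
  rw [Measure.real, surfaceMeasure_apply (measurableSet_sphericalCap (b 0) ρ), hvol,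
    ENNReal.toReal_mul, ENNReal.toReal_mul, ENNReal.toReal_ofReal (by norm_num),
    ENNReal.toReal_ofReal (by have := hρ.1; have := pi_pos; ring_nf; positivity)]
  simp

theorem measurePreserving_surfaceMeasure (T : E3 ≃ₗᵢ[ℝ] E3) :
    MeasurePreserving T surfaceMeasure surfaceMeasure := by
  refine ⟨T.continuous.measurable, ?_⟩
  ext A hA
  rw [Measure.map_apply T.continuous.measurable hA, surfaceMeasure_apply hA,
    surfaceMeasure_apply (T.continuous.measurable hA),
    ← T.measurePreserving.measure_preimage_emb T.toHomeomorph.measurableEmbedding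
      {x : E3 | 0 < ‖x‖ ∧ ‖x‖ < 1 ∧ ‖x‖⁻¹ • x ∈ A}]
  congr 2
  ext x
  simp

end CapMeasure

/-! ### Averaging over rotations about the axis of the cap -/

section CapMean

/-- Rotation by the angle `θ` about the first vector of an orthonormal basis. -/
noncomputable def rotate (b : OrthonormalBasis (Fin 3) ℝ E3) (θ : ℝ) (η : E3) : E3 :=
  frame (b 0) (b 1) (b 2) ⟪b 0, η⟫ (cos θ * ⟪b 1, η⟫ - sin θ * ⟪b 2, η⟫)
    (sin θ * ⟪b 1, η⟫ + cos θ * ⟪b 2, η⟫)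

theorem orthonormal_frame (b : OrthonormalBasis (Fin 3) ℝ E3) :
    Orthonormal ℝ ![b 0, b 1, b 2] := by
  have : (![b 0, b 1, b 2] : Fin 3 → E3) = b := by
    ext i; fin_cases i <;> rfl
  rw [this]
  exact b.orthonormal

theorem eq_frame_inner (b : OrthonormalBasis (Fin 3) ℝ E3) (η : E3) :
    η = frame (b 0) (b 1) (b 2) ⟪b 0, η⟫ ⟪b 1, η⟫ ⟪b 2, η⟫ := by
  conv_lhs => rw [← b.sum_repr' η, Fin.sum_univ_three]
  rfl

theorem inner_frame_fst {u v w : E3} (h : Orthonormal ℝ ![u, v, w]) (α β γ : ℝ) :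
    ⟪u, frame u v w α β γ⟫ = α := by
  have := inner_frame h 1 0 0 α β γ
  rw [frame_one] at this
  linarith

theorem inner_frame_snd {u v w : E3} (h : Orthonormal ℝ ![u, v, w]) (α β γ : ℝ) :
    ⟪v, frame u v w α β γ⟫ = β := by
  have := inner_frame h 0 1 0 α β γ
  rw [show frame u v w 0 1 0 = v by simp [frame]] at this
  linarith

theorem inner_frame_trd {u v w : E3} (h : Orthonormal ℝ ![u, v, w]) (α β γ : ℝ) :
    ⟪w, frame u v w α β γ⟫ = γ := by
  have := inner_frame h 0 0 1 α β γ
  rw [show frame u v w 0 0 1 = w by simp [frame]] at this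
  linarith

theorem continuous_rotate (b : OrthonormalBasis (Fin 3) ℝ E3) :
    Continuous fun p : ℝ × E3 => rotate b p.1 p.2 := by
  unfold rotate frame
  fun_prop

theorem exists_linearIsometryEquiv_rotate (b : OrthonormalBasis (Fin 3) ℝ E3) (θ : ℝ) :
    ∃ T : E3 ≃ₗᵢ[ℝ] E3, ∀ η, T η = rotate b θ η := by
  have h := orthonormal_frame b
  set v : Fin 3 → E3 := ![frame (b 0) (b 1) (b 2) 1 0 0,
    frame (b 0) (b 1) (b 2) 0 (cos θ) (sin θ), frame (b 0) (b 1) (b 2) 0 (-sin θ) (cos θ)] with hv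
  have hvo : Orthonormal ℝ v := by
    rw [orthonormal_iff_ite]
    intro i j
    fin_cases i <;> fin_cases j <;>
      simp [hv, inner_frame h, -inner_self_eq_norm_sq_to_K]
    · nlinarith [sin_sq_add_cos_sq θ]
    · ring
    · ring
    · nlinarith [sin_sq_add_cos_sq θ]
  set B := (basisOfOrthonormalOfCardEqFinrank hvo (by simp)).toOrthonormalBasis (by simpa using hvo)
    with hB
  refine ⟨b.equiv B (Equiv.refl _), fun η => ?_⟩
  rw [OrthonormalBasis.equiv_apply, Fin.sum_univ_three]
  simp [hB, hv, rotate, frame, b.repr_apply_apply]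
  module

theorem circleMap_zero_one_re_im (R θ : ℝ) :
    (circleMap 0 R θ).re = R * cos θ ∧ (circleMap 0 R θ).im = R * sin θ := by
  simp [circleMap, Complex.exp_ofReal_mul_I_re, Complex.exp_ofReal_mul_I_im]

theorem rotate_stereo (b : OrthonormalBasis (Fin 3) ℝ E3) (θ x y : ℝ) :
    rotate b θ (stereo (b 0) (b 1) (b 2) x y) =
      stereo (b 0) (b 1) (b 2) (cos θ * x - sin θ * y) (sin θ * x + cos θ * y) := by
  have h := orthonormal_frame b
  have e : (cos θ * x - sin θ * y) ^ 2 + (sin θ * x + cos θ * y) ^ 2 = x ^ 2 + y ^ 2 := by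
    linear_combination (x ^ 2 + y ^ 2) * sin_sq_add_cos_sq θ
  simp only [rotate, stereo, inner_frame_fst h, inner_frame_snd h, inner_frame_trd h]
  congr 1
  · rw [sub_sub, sub_sub, add_assoc, add_assoc, e]
  · rw [add_assoc 1 ((cos θ * x - sin θ * y) ^ 2), e, ← add_assoc]
    ring
  · rw [add_assoc 1 ((cos θ * x - sin θ * y) ^ 2), e, ← add_assoc]
    ring

theorem rotate_mem_sphericalCap (b : OrthonormalBasis (Fin 3) ℝ E3) (θ : ℝ) {ρ : ℝ} {η : E3} :
    rotate b θ η ∈ sphericalCap (b 0) ρ ↔ η ∈ sphericalCap (b 0) ρ := by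
  obtain ⟨T, hT⟩ := exists_linearIsometryEquiv_rotate b θ
  have h0 : ⟪b 0, rotate b θ η⟫ = ⟪b 0, η⟫ := inner_frame_fst (orthonormal_frame b) _ _ _
  have h1 : ‖rotate b θ η‖ = ‖η‖ := by rw [← hT, T.norm_map]
  simp only [sphericalCap, unitSphere, mem_ofPred_eq, mem_sphere_zero_iff_norm, h0, h1]

theorem isCompact_closure_sphericalCap (ζ : E3) (ρ : ℝ) :
    IsCompact (closure (sphericalCap ζ ρ)) :=
  (isCompact_sphere (0 : E3) 1).of_isClosed_subset isClosed_closure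
    (closure_minimal (fun _ h => h.1) Metric.isClosed_sphere)

theorem integral_sphericalCap_rotate (b : OrthonormalBasis (Fin 3) ℝ E3) (θ ρ : ℝ) (U : E3 → ℝ) :
    ∫ η in sphericalCap (b 0) ρ, U (rotate b θ η) ∂surfaceMeasure =
      ∫ η in sphericalCap (b 0) ρ, U η ∂surfaceMeasure := by
  obtain ⟨T, hT⟩ := exists_linearIsometryEquiv_rotate b θ
  rw [← (measurePreserving_surfaceMeasure T).setIntegral_preimage_emb
    T.toHomeomorph.measurableEmbedding U]
  have : T ⁻¹' sphericalCap (b 0) ρ = sphericalCap (b 0) ρ := by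
    ext η
    rw [mem_preimage, hT, rotate_mem_sphericalCap]
  rw [this]
  simp only [hT]

/-- Integration over a cap of a function whose average over every parallel circle is `m`. -/
theorem integral_sphericalCap_of_rotate_average (b : OrthonormalBasis (Fin 3) ℝ E3) {ρ : ℝ}
    {U : E3 → ℝ} (hU : ContinuousOn U (closure (sphericalCap (b 0) ρ))) {m : ℝ}
    (hm : ∀ η ∈ sphericalCap (b 0) ρ, ∫ θ in (0 : ℝ)..2 * π, U (rotate b θ η) = 2 * π * m) :
    ∫ η in sphericalCap (b 0) ρ, U η ∂surfaceMeasure =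
      m * surfaceMeasure.real (sphericalCap (b 0) ρ) := by
  set Γ := sphericalCap (b 0) ρ with hΓ
  have hΓm : MeasurableSet Γ := measurableSet_sphericalCap _ _
  obtain ⟨C, hC⟩ := (isCompact_closure_sphericalCap (b 0) ρ).exists_bound_of_continuousOn hU
  have hmaps : MapsTo (fun p : ℝ × E3 => rotate b p.1 p.2) (Ioc 0 (2 * π) ×ˢ Γ) (closure Γ) :=
    fun p hp => subset_closure ((rotate_mem_sphericalCap b p.1).2 hp.2)
  -- For Fubini: U is bounded on the compact closed cap, which contains all rotated points, and the
  -- product measure is finite.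
  have hint : Integrable (Function.uncurry fun θ η => U (rotate b θ η))
      ((volume.restrict (Ioc 0 (2 * π))).prod (surfaceMeasure.restrict Γ)) := by
    rw [Measure.prod_restrict]
    have hms : MeasurableSet (Ioc 0 (2 * π) ×ˢ Γ) := measurableSet_Ioc.prod hΓm
    have hfin : (volume.prod surfaceMeasure) (Ioc 0 (2 * π) ×ˢ Γ) < ⊤ := by
      rw [Measure.prod_prod]
      exact ENNReal.mul_lt_top measure_Ioc_lt_top (measure_lt_top _ _)
    refine IntegrableOn.of_bound (C := C) hfin ?_ ?_
    · exact (hU.comp (continuous_rotate b).continuousOn hmaps).aestronglyMeasurable hms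
    · filter_upwards [ae_restrict_mem hms] with p hp
      exact hC _ (hmaps hp)
  -- By rotation invariance the inner integral does not depend on θ; exchanging the order brings in
  -- the circle averages.
  have h1 : ∫ θ in (0 : ℝ)..2 * π, ∫ η in Γ, U (rotate b θ η) ∂surfaceMeasure =
      2 * π * ∫ η in Γ, U η ∂surfaceMeasure := by
    simp only [hΓ, integral_sphericalCap_rotate]
    simp
  rw [intervalIntegral.integral_of_le two_pi_pos.le, integral_integral_swap hint] at h1
  have h2 : ∫ η in Γ, (∫ θ in Ioc 0 (2 * π), U (rotate b θ η)) ∂surfaceMeasure =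
      ∫ η in Γ, 2 * π * m ∂surfaceMeasure := by
    refine setIntegral_congr_fun hΓm fun η hη => ?_
    rw [← hm η hη, intervalIntegral.integral_of_le two_pi_pos.le]
  rw [h2, setIntegral_const, smul_eq_mul] at h1
  have := two_pi_pos.ne'
  apply mul_left_cancel₀ this
  rw [← h1]
  ring

end CapMean

/-! ### Derivatives of logarithmic potentials on the sphere -/

section LogFunctions

/-- The radially constant extension of `η ↦ log (1 - b·η)`. -/
noncomputable def radialLog (b : E3) : E3 → ℝ := radialExt fun η => log (1 - ⟪b, η⟫)

theorem contDiffAt_radialLog {b x : E3} {k : WithTop ℕ∞} (hx : x ≠ 0)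
    (h : ⟪b, ‖x‖⁻¹ • x⟫ ≠ 1) : ContDiffAt ℝ k (radialLog b) x := by
  have h1 : ContDiffAt ℝ k (fun x : E3 => ‖x‖⁻¹ • x) x :=
    ((contDiffAt_norm ℝ hx).inv (norm_ne_zero_iff.2 hx)).smul contDiffAt_id
  exact (contDiffAt_const.sub (contDiffAt_const.inner ℝ h1)).log (sub_ne_zero.2 h.symm)

theorem contDiffAt_radialLog_of_norm_one {b x : E3} {k : WithTop ℕ∞} (hx : ‖x‖ = 1)
    (h : ⟪b, x⟫ ≠ 1) : ContDiffAt ℝ k (radialLog b) x :=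
  contDiffAt_radialLog (by rintro rfl; simp at hx) (by simpa [hx] using h)

theorem inner_lt_one_of_norm_one {b x : E3} (hb : ‖b‖ = 1) (hx : ‖x‖ = 1) (h : ⟪b, x⟫ ≠ 1) :
    ⟪b, x⟫ < 1 := by
  refine lt_of_le_of_ne ?_ h
  simpa [hb, hx] using real_inner_le_norm b x

/-- Along y = x + tv one has |y|² = 1 + 2(x·v)t + t² and log(1 - b·y/|y|) = log(|y| - b·y) - log|y|.
The direction v need not be tangential, since the Laplacian is later summed over a fixed basis of
the space. -/
theorem eventually_hasDerivAt_radialLog_line {b x v : E3} (hb : ‖b‖ = 1) (hx : ‖x‖ = 1)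
    (hv : ‖v‖ = 1) (h : ⟪b, x⟫ ≠ 1) : ∀ᶠ t in 𝓝 (0 : ℝ), HasDerivAt (fun t => radialLog b (x + t • v))
      (((⟪x, v⟫ + t) / √(1 + 2 * ⟪x, v⟫ * t + t ^ 2) - ⟪b, v⟫) /
        (√(1 + 2 * ⟪x, v⟫ * t + t ^ 2) - (⟪b, x⟫ + t * ⟪b, v⟫)) -
        (⟪x, v⟫ + t) / (1 + 2 * ⟪x, v⟫ * t + t ^ 2)) t := by
  set c := ⟪x, v⟫
  have hβ := inner_lt_one_of_norm_one hb hx h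
  have e1 : ∀ᶠ t in 𝓝 (0 : ℝ), 0 < 1 + 2 * c * t + t ^ 2 :=
    (by fun_prop : Continuous fun t : ℝ => 1 + 2 * c * t + t ^ 2).continuousAt.eventually
      (Ioi_mem_nhds (by simp))
  have e2 : ∀ᶠ t in 𝓝 (0 : ℝ), 0 < √(1 + 2 * c * t + t ^ 2) - (⟪b, x⟫ + t * ⟪b, v⟫) :=
    (by fun_prop : Continuous fun t : ℝ => √(1 + 2 * c * t + t ^ 2) -
      (⟪b, x⟫ + t * ⟪b, v⟫)).continuousAt.eventually (Ioi_mem_nhds (by simpa using hβ))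
  have heq : ∀ᶠ t in 𝓝 (0 : ℝ), radialLog b (x + t • v) =
      log (√(1 + 2 * c * t + t ^ 2) - (⟪b, x⟫ + t * ⟪b, v⟫)) -
        1 / 2 * log (1 + 2 * c * t + t ^ 2) := by
    filter_upwards [e1, e2] with t h1 h2
    have hn : ‖x + t • v‖ = √(1 + 2 * c * t + t ^ 2) := by
      rw [eq_comm, sqrt_eq_iff_mul_self_eq h1.le (norm_nonneg _), ← sq, norm_add_sq_real, norm_smul,
        hx, hv, inner_smul_right, mul_one, norm_eq_abs, sq_abs]
      ring
    have hs := sqrt_pos.2 h1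
    simp only [radialLog, radialExt, hn, inner_smul_right, inner_add_right]
    rw [show 1 - (√(1 + 2 * c * t + t ^ 2))⁻¹ * (⟪b, x⟫ + t * ⟪b, v⟫) =
      (√(1 + 2 * c * t + t ^ 2) - (⟪b, x⟫ + t * ⟪b, v⟫)) / √(1 + 2 * c * t + t ^ 2) by
        field_simp, log_div h2.ne' hs.ne', log_sqrt h1.le]
    ring
  filter_upwards [e1, e2, heq.eventually_nhds] with t h1 h2 h3
  refine HasDerivAt.congr_of_eventuallyEq ?_ h3
  have hs := sqrt_pos.2 h1
  have hq : HasDerivAt (fun t : ℝ => 1 + 2 * c * t + t ^ 2) (2 * (c + t)) t := by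
    have := (((hasDerivAt_id' t).const_mul (2 * c)).const_add 1).fun_add ((hasDerivAt_id' t).fun_pow 2)
    refine this.congr_deriv ?_
    push_cast
    ring
  have hN : HasDerivAt (fun t : ℝ => ⟪b, x⟫ + t * ⟪b, v⟫) ⟪b, v⟫ t := by
    simpa using ((hasDerivAt_id' t).mul_const ⟪b, v⟫).const_add ⟪b, x⟫
  refine ((((hq.sqrt h1.ne').fun_sub hN).log h2.ne').fun_sub
    ((hq.log h1.ne').const_mul (1 / 2))).congr_deriv ?_
  field_simp

theorem iteratedFDeriv_two_radialLog {b x v : E3} (hb : ‖b‖ = 1) (hx : ‖x‖ = 1)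
    (hv : ‖v‖ = 1) (h : ⟪b, x⟫ ≠ 1) : iteratedFDeriv ℝ 2 (radialLog b) x ![v, v] =
      (1 - ⟪x, v⟫ ^ 2) / (1 - ⟪b, x⟫) - (⟪x, v⟫ - ⟪b, v⟫) ^ 2 / (1 - ⟪b, x⟫) ^ 2 -
        (1 - 2 * ⟪x, v⟫ ^ 2) := by
  refine (contDiffAt_radialLog_of_norm_one hx h).iteratedFDeriv_two_eq_of_line
    (eventually_hasDerivAt_radialLog_line hb hx hv h) ?_
  set c := ⟪x, v⟫
  have hβ : 1 - ⟪b, x⟫ ≠ 0 := sub_ne_zero.2 h.symm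
  have h1 : (1 : ℝ) + 2 * c * 0 + 0 ^ 2 = 1 := by ring
  have hq : HasDerivAt (fun t : ℝ => 1 + 2 * c * t + t ^ 2) (2 * c) 0 := by
    have := (((hasDerivAt_id' (0 : ℝ)).const_mul (2 * c)).const_add 1).fun_add
      ((hasDerivAt_id' (0 : ℝ)).fun_pow 2)
    refine this.congr_deriv ?_
    simp
  have hs : HasDerivAt (fun t : ℝ => √(1 + 2 * c * t + t ^ 2)) c 0 := by
    refine (hq.sqrt (by rw [h1]; exact one_ne_zero)).congr_deriv ?_
    rw [h1, sqrt_one]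
    ring
  have hct : HasDerivAt (fun t : ℝ => c + t) 1 0 := (hasDerivAt_id' (0 : ℝ)).const_add c
  have hN : HasDerivAt (fun t : ℝ => ⟪b, x⟫ + t * ⟪b, v⟫) ⟪b, v⟫ 0 := by
    simpa using ((hasDerivAt_id' (0 : ℝ)).mul_const ⟪b, v⟫).const_add ⟪b, x⟫
  have hs0 : √(1 + 2 * c * 0 + 0 ^ 2) = 1 := by rw [h1, sqrt_one]
  refine ((((hct.fun_div hs (by rw [hs0]; exact one_ne_zero)).sub_const ⟪b, v⟫).fun_div
    (hs.fun_sub hN) (by rw [hs0]; simpa using hβ)).fun_sub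
    (hct.fun_div hq (by rw [h1]; exact one_ne_zero))).congr_deriv ?_
  simp only [h1, sqrt_one, zero_mul, add_zero]
  field_simp

/-- Parseval gives Σ(x·eᵢ)² = 1 and Σ((x - b)·eᵢ)² = 2(1 - b·x). The two singular terms 2/(1 - b·x)
then cancel, and -(3 - 2) remains. -/
theorem laplacian_radialLog {b x : E3} (hb : ‖b‖ = 1) (hx : ‖x‖ = 1) (h : ⟪b, x⟫ ≠ 1) :
    Laplacian.laplacian (radialLog b) x = -1 := by
  set B := EuclideanSpace.basisFun (Fin 3) ℝ
  have hβ : 1 - ⟪b, x⟫ ≠ 0 := sub_ne_zero.2 h.symm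
  rw [InnerProductSpace.laplacian_eq_iteratedFDeriv_orthonormalBasis _ B]
  simp only [iteratedFDeriv_two_radialLog hb hx (B.orthonormal.1 _) h]
  have h1 : ∑ i, ⟪x, B i⟫ ^ 2 = 1 := by
    have := B.sum_sq_norm_inner_left x
    simpa [hx] using this
  have h2 : ∑ i, (⟪x, B i⟫ - ⟪b, B i⟫) ^ 2 = 2 * (1 - ⟪b, x⟫) := by
    have := B.sum_sq_norm_inner_left (x - b)
    simp only [norm_eq_abs, sq_abs, inner_sub_left] at this
    rw [this, norm_sub_sq_real, hx, hb, real_inner_comm]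
    ring
  rw [Finset.sum_sub_distrib, Finset.sum_sub_distrib, ← Finset.sum_div, ← Finset.sum_div,
    Finset.sum_sub_distrib, Finset.sum_sub_distrib, ← Finset.mul_sum, h1, h2]
  simp
  field_simp
  ring

theorem fderiv_radialLog {b x v : E3} (hb : ‖b‖ = 1) (hx : ‖x‖ = 1) (hv : ‖v‖ = 1)
    (hxv : ⟪x, v⟫ = 0) (h : ⟪b, x⟫ ≠ 1) :
    fderiv ℝ (radialLog b) x v = -(⟪b, v⟫ / (1 - ⟪b, x⟫)) := by
  have h1 := (eventually_hasDerivAt_radialLog_line hb hx hv h).self_of_nhds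
  have hγ : HasDerivAt (fun t : ℝ => x + t • v) v 0 := by
    simpa using ((hasDerivAt_id (0 : ℝ)).smul_const v).const_add x
  have hd : HasFDerivAt (radialLog b) (fderiv ℝ (radialLog b) x) (x + (0 : ℝ) • v) := by
    simpa using ((contDiffAt_radialLog_of_norm_one (k := 1) hx h).differentiableAt
      one_ne_zero).hasFDerivAt
  rw [(hd.comp_hasDerivAt 0 hγ).unique h1, hxv]
  simp [neg_div]

/-- The functions on the sphere spanned by constants and two logarithmic potentials. -/
noncomputable def logComb (c₀ A B : ℝ) (b₁ b₂ η : E3) : ℝ :=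
  c₀ + A * log (1 - ⟪b₁, η⟫) + B * log (1 - ⟪b₂, η⟫)

theorem radialExt_logComb (c₀ A B : ℝ) (b₁ b₂ : E3) : radialExt (logComb c₀ A B b₁ b₂) =
    (fun _ => c₀) + A • radialLog b₁ + B • radialLog b₂ := rfl

variable {c₀ A B : ℝ} {b₁ b₂ : E3}

theorem contDiffAt_logComb {k : WithTop ℕ∞} {x : E3} (hx : x ≠ 0) (h₁ : ⟪b₁, ‖x‖⁻¹ • x⟫ ≠ 1)
    (h₂ : ⟪b₂, ‖x‖⁻¹ • x⟫ ≠ 1) : ContDiffAt ℝ k (radialExt (logComb c₀ A B b₁ b₂)) x := by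
  rw [radialExt_logComb]
  exact (contDiffAt_const.add (contDiffAt_const.smul (contDiffAt_radialLog hx h₁))).add
    (contDiffAt_const.smul (contDiffAt_radialLog hx h₂))

theorem sphereContDiffOn_logComb {k : WithTop ℕ∞} {S : Set E3}
    (h₁ : ∀ η ∈ S, ⟪b₁, η⟫ ≠ 1) (h₂ : ∀ η ∈ S, ⟪b₂, η⟫ ≠ 1) :
    SphereContDiffOn k (logComb c₀ A B b₁ b₂) S := fun _ hx =>
  (contDiffAt_logComb hx.1 (h₁ _ hx.2) (h₂ _ hx.2)).contDiffWithinAt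

theorem beltrami_logComb {x : E3} (hx : ‖x‖ = 1) (hb₁ : ‖b₁‖ = 1) (hb₂ : ‖b₂‖ = 1)
    (h₁ : ⟪b₁, x⟫ ≠ 1) (h₂ : ⟪b₂, x⟫ ≠ 1) : beltrami (logComb c₀ A B b₁ b₂) x = -A - B := by
  have c1 := contDiffAt_radialLog_of_norm_one (k := 2) hx h₁
  have c2 := contDiffAt_radialLog_of_norm_one (k := 2) hx h₂
  have c3 : ContDiffAt ℝ 2 (A • radialLog b₁) x := contDiffAt_const.smul c1
  have c4 : ContDiffAt ℝ 2 (B • radialLog b₂) x := contDiffAt_const.smul c2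
  have c5 : ContDiffAt ℝ 2 (fun _ : E3 => c₀) x := contDiffAt_const
  have c6 : ContDiffAt ℝ 2 ((fun _ : E3 => c₀) + A • radialLog b₁) x := c5.add c3
  rw [beltrami, radialExt_logComb, c6.laplacian_add c4, c5.laplacian_add c3,
    InnerProductSpace.laplacian_smul A c1, InnerProductSpace.laplacian_smul B c2,
    laplacian_radialLog hb₁ hx h₁, laplacian_radialLog hb₂ hx h₂,
    InnerProductSpace.laplacian_const]
  simp
  ring

theorem inner_surfaceGradient {F : E3 → ℝ} {x : E3} (v : E3) :
    ⟪v, surfaceGradient F x⟫ = fderiv ℝ (radialExt F) x v := by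
  rw [surfaceGradient, gradient, real_inner_comm]
  simp

theorem inner_surfaceGradient_logComb {x v : E3} (hx : ‖x‖ = 1) (hv : ‖v‖ = 1)
    (hxv : ⟪x, v⟫ = 0) (hb₁ : ‖b₁‖ = 1) (hb₂ : ‖b₂‖ = 1)
    (h₁ : ⟪b₁, x⟫ ≠ 1) (h₂ : ⟪b₂, x⟫ ≠ 1) :
    ⟪v, surfaceGradient (logComb c₀ A B b₁ b₂) x⟫ =
      -A * (⟪b₁, v⟫ / (1 - ⟪b₁, x⟫)) - B * (⟪b₂, v⟫ / (1 - ⟪b₂, x⟫)) := by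
  have c1 := (contDiffAt_radialLog_of_norm_one (k := 1) hx h₁).differentiableAt one_ne_zero
  have c2 := (contDiffAt_radialLog_of_norm_one (k := 1) hx h₂).differentiableAt one_ne_zero
  rw [inner_surfaceGradient, radialExt_logComb, (((hasFDerivAt_const c₀ x).add
    (c1.hasFDerivAt.const_smul A)).add (c2.hasFDerivAt.const_smul B)).fderiv]
  simp only [zero_add, _root_.add_apply, _root_.smul_apply, smul_eq_mul]
  rw [fderiv_radialLog hb₁ hx hv hxv h₁, fderiv_radialLog hb₂ hx hv hxv h₂]
  ring

/-- The gradient is continuous at η and the inward points converge to η, so the one-sided limit is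
the value. -/
theorem hasInnerNormalDeriv_of_contDiffAt {F : E3 → ℝ} {ν : E3 → E3} {η : E3}
    (hF : ContDiffAt ℝ 1 (radialExt F) η) :
    HasInnerNormalDeriv ν F η (normalDeriv ν F η) := by
  unfold HasInnerNormalDeriv normalDeriv
  simp only [inner_surfaceGradient]
  have h1 : ContinuousAt (fderiv ℝ (radialExt F)) η := hF.continuousAt_fderiv one_ne_zero
  have h2 : Tendsto (fun τ : ℝ => (√(1 + τ ^ 2))⁻¹ • (η - τ • ν η)) (𝓝 0) (𝓝 η) := by
    have : Continuous fun τ : ℝ => (√(1 + τ ^ 2))⁻¹ • (η - τ • ν η) :=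
      Continuous.smul (Continuous.inv₀ (by fun_prop) fun τ => (sqrt_pos.2 (by positivity)).ne')
        (by fun_prop)
    simpa using this.tendsto 0
  have h3 : Tendsto (fun τ : ℝ => fderiv ℝ (radialExt F) ((√(1 + τ ^ 2))⁻¹ • (η - τ • ν η))) (𝓝 0)
      (𝓝 (fderiv ℝ (radialExt F) η)) := h1.tendsto.comp h2
  exact (((ContinuousLinearMap.apply ℝ ℝ (ν η)).continuous.tendsto _).comp h3).mono_left
    nhdsWithin_le_nhds

end LogFunctions

/-! ### Reflection in the boundary circle and the Neumann Green function -/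

section CapGeometry

variable {ζ ξ η : E3} {ρ : ℝ}

theorem mem_sphericalCap_iff : η ∈ sphericalCap ζ ρ ↔ ‖η‖ = 1 ∧ 1 - ρ < ⟪ζ, η⟫ := by
  simp only [sphericalCap, unitSphere, mem_ofPred_eq, mem_sphere_zero_iff_norm, sub_lt_comm]

theorem of_mem_closure_sphericalCap (h : η ∈ closure (sphericalCap ζ ρ)) :
    ‖η‖ = 1 ∧ 1 - ρ ≤ ⟪ζ, η⟫ := by
  have hc : IsClosed {η : E3 | ‖η‖ = 1 ∧ 1 - ρ ≤ ⟪ζ, η⟫} :=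
    (isClosed_eq continuous_norm continuous_const).inter
      (isClosed_le (f := fun _ : E3 => 1 - ρ) (g := fun η : E3 => ⟪ζ, η⟫) continuous_const
        (by fun_prop))
  refine closure_minimal (fun η hη => ?_) hc h
  exact ⟨(mem_sphericalCap_iff.1 hη).1, (mem_sphericalCap_iff.1 hη).2.le⟩

theorem of_mem_boundaryOf_sphericalCap (h : η ∈ boundaryOf (sphericalCap ζ ρ)) :
    ‖η‖ = 1 ∧ ⟪ζ, η⟫ = 1 - ρ := by
  obtain ⟨h1, h2⟩ := of_mem_closure_sphericalCap h.1
  refine ⟨h1, le_antisymm (not_lt.1 fun h3 => h.2 (mem_sphericalCap_iff.2 ⟨h1, h3⟩)) h2⟩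

theorem scalingFactor_eq : scalingFactor ζ ρ ξ =
    (1 - 2 * ⟪ξ, ζ⟫ * (1 - ρ) + (1 - ρ) ^ 2) / (ρ * (2 - ρ)) := by
  rw [scalingFactor, ← neg_div_neg_eq, ← neg_div]
  congr 1 <;> ring

/-- The numerator is |ξ - (1-ρ)ζ|², which is positive because |1-ρ| < 1. -/
theorem scalingFactor_pos (hζ : ‖ζ‖ = 1) (hρ : ρ ∈ Ioo (0 : ℝ) 2) (hξ : ‖ξ‖ = 1) :
    0 < scalingFactor ζ ρ ξ := by
  rw [scalingFactor_eq]
  have h1 := abs_le.1 (abs_real_inner_le_norm ξ ζ)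
  rw [hζ, hξ, one_mul] at h1
  obtain ⟨h2, h3⟩ := hρ
  refine div_pos ?_ (mul_pos h2 (by linarith))
  rcases le_total ρ 1 with h | h
  · nlinarith [mul_nonneg (sub_nonneg.2 h) (sub_nonneg.2 h1.2), sq_nonneg (1 - (1 - ρ))]
  · nlinarith [mul_nonneg (sub_nonneg.2 h) (sub_nonneg.2 h1.1)]

/-- The factor ρ - 1 divides ř - 1, so multiplying by ř removes the singular quotient and treats the
hemisphere ρ = 1 together with all other caps. -/
theorem scalingFactor_smul_reflectionPoint (hζ : ‖ζ‖ = 1) (hρ : ρ ∈ Ioo (0 : ℝ) 2)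
    (hξ : ‖ξ‖ = 1) : scalingFactor ζ ρ ξ • reflectionPoint ζ ρ ξ =
      ξ + (2 * (1 - ρ - ⟪ξ, ζ⟫) / (ρ * (2 - ρ))) • ζ := by
  have hr := (scalingFactor_pos hζ hρ hξ).ne'
  have h1 : ρ ≠ 0 := hρ.1.ne'
  have h2 : 2 - ρ ≠ 0 := (sub_pos.2 hρ.2).ne'
  rw [reflectionPoint]
  split_ifs with h
  · subst h
    rw [scalingFactor_eq]
    norm_num
    module
  · have h3 : ρ - 1 ≠ 0 := sub_ne_zero.2 h
    rw [smul_sub, smul_smul, smul_smul, mul_one_div_cancel hr, one_smul, sub_eq_add_neg, ← neg_smul]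
    congr 2
    rw [show scalingFactor ζ ρ ξ * ((scalingFactor ζ ρ ξ - 1) / (scalingFactor ζ ρ ξ * (ρ - 1))) =
      (scalingFactor ζ ρ ξ - 1) / (ρ - 1) by field_simp, scalingFactor_eq]
    field_simp
    ring

theorem scalingFactor_mul_inner (hζ : ‖ζ‖ = 1) (hρ : ρ ∈ Ioo (0 : ℝ) 2) (hξ : ‖ξ‖ = 1) (v : E3) :
    scalingFactor ζ ρ ξ * ⟪reflectionPoint ζ ρ ξ, v⟫ =
      ⟪ξ, v⟫ + 2 * (1 - ρ - ⟪ξ, ζ⟫) / (ρ * (2 - ρ)) * ⟪ζ, v⟫ := by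
  rw [← real_inner_smul_left, scalingFactor_smul_reflectionPoint hζ hρ hξ, inner_add_left,
    real_inner_smul_left]

theorem norm_reflectionPoint (hζ : ‖ζ‖ = 1) (hρ : ρ ∈ Ioo (0 : ℝ) 2) (hξ : ‖ξ‖ = 1) :
    ‖reflectionPoint ζ ρ ξ‖ = 1 := by
  have hr := scalingFactor_pos hζ hρ hξ
  have h1 : ρ ≠ 0 := hρ.1.ne'
  have h2 : 2 - ρ ≠ 0 := (sub_pos.2 hρ.2).ne'
  have h : ‖scalingFactor ζ ρ ξ • reflectionPoint ζ ρ ξ‖ ^ 2 = scalingFactor ζ ρ ξ ^ 2 := by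
    rw [scalingFactor_smul_reflectionPoint hζ hρ hξ, norm_add_sq_real, norm_smul, hξ, hζ,
      inner_smul_right, mul_one, norm_eq_abs, sq_abs, scalingFactor_eq]
    field_simp
    ring
  rw [norm_smul, norm_of_nonneg hr.le, mul_pow] at h
  have h3 : ‖reflectionPoint ζ ρ ξ‖ ^ 2 = 1 := by
    have := pow_pos hr 2
    field_simp at h
    exact h
  exact (pow_eq_one_iff_of_nonneg (norm_nonneg _) two_ne_zero).1 h3

/-- Reflection exchanges the two sides of the circle: ř((1-ρ) - ζ·ξ̌) = ζ·ξ - (1-ρ). This keeps the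
pole of the second potential off the closed cap. -/
theorem inner_reflectionPoint_lt (hζ : ‖ζ‖ = 1) (hρ : ρ ∈ Ioo (0 : ℝ) 2)
    (hξ : ξ ∈ sphericalCap ζ ρ) : ⟪ζ, reflectionPoint ζ ρ ξ⟫ < 1 - ρ := by
  obtain ⟨hξ1, hξ2⟩ := mem_sphericalCap_iff.1 hξ
  have hr := scalingFactor_pos hζ hρ hξ1
  have h := scalingFactor_mul_inner hζ hρ hξ1 ζ
  have h1 : 0 < ρ := hρ.1
  have h2 : 0 < 2 - ρ := sub_pos.2 hρ.2
  rw [real_inner_self_eq_norm_sq, hζ] at h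
  rw [real_inner_comm] at hξ2 ⊢
  refine lt_of_mul_lt_mul_left (?_ : scalingFactor ζ ρ ξ * _ < scalingFactor ζ ρ ξ * _) hr.le
  rw [h, ← sub_pos, scalingFactor_eq]
  have : (1 - 2 * ⟪ξ, ζ⟫ * (1 - ρ) + (1 - ρ) ^ 2) / (ρ * (2 - ρ)) * (1 - ρ) -
      (⟪ξ, ζ⟫ + 2 * (1 - ρ - ⟪ξ, ζ⟫) / (ρ * (2 - ρ)) * 1 ^ 2) = ⟪ξ, ζ⟫ - (1 - ρ) := by
    field_simp
    ring
  rw [this]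
  linarith

theorem inner_reflectionPoint_ne_one (hζ : ‖ζ‖ = 1) (hρ : ρ ∈ Ioo (0 : ℝ) 2)
    (hξ : ξ ∈ sphericalCap ζ ρ) (hη : η ∈ closure (sphericalCap ζ ρ)) :
    ⟪reflectionPoint ζ ρ ξ, η⟫ ≠ 1 := by
  obtain ⟨h1, h2⟩ := of_mem_closure_sphericalCap hη
  intro h
  rw [inner_eq_one_iff_of_norm_eq_one
    (norm_reflectionPoint hζ hρ (mem_sphericalCap_iff.1 hξ).1) h1] at h
  have := inner_reflectionPoint_lt hζ hρ hξ
  rw [h] at this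
  linarith

theorem inner_neg_ne_one (hρ : ρ ∈ Ioo (0 : ℝ) 2) (hη : η ∈ closure (sphericalCap ζ ρ)) :
    ⟪-ζ, η⟫ ≠ 1 := by
  obtain ⟨h1, h2⟩ := of_mem_closure_sphericalCap hη
  rw [inner_neg_left]
  have := hρ.2
  linarith

theorem inner_ne_one_of_ne (hξ : ‖ξ‖ = 1) (hη : ‖η‖ = 1) (h : ξ ≠ η) : ⟪ξ, η⟫ ≠ 1 := fun h' =>
  h ((inner_eq_one_iff_of_norm_eq_one hξ hη).1 h')

theorem norm_sq_tangential (hζ : ‖ζ‖ = 1) (hη : ‖η‖ = 1) :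
    ‖ζ - ⟪ζ, η⟫ • η‖ ^ 2 = 1 - ⟪ζ, η⟫ ^ 2 := by
  rw [norm_sub_sq_real, norm_smul, hζ, hη, inner_smul_right, mul_one, norm_eq_abs, sq_abs]
  ring

theorem capNormal_spec (hζ : ‖ζ‖ = 1) (hη : ‖η‖ = 1) (h1 : -1 < ⟪ζ, η⟫) (h2 : ⟪ζ, η⟫ < 1) :
    ‖capNormal ζ η‖ = 1 ∧ ⟪η, capNormal ζ η⟫ = 0 ∧
      ∀ w, ⟪w, capNormal ζ η⟫ = -((⟪w, ζ⟫ - ⟪ζ, η⟫ * ⟪w, η⟫) / √(1 - ⟪ζ, η⟫ ^ 2)) := by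
  have hpos : 0 < 1 - ⟪ζ, η⟫ ^ 2 := by nlinarith
  have hn : ‖ζ - ⟪ζ, η⟫ • η‖ = √(1 - ⟪ζ, η⟫ ^ 2) := by
    rw [← norm_sq_tangential hζ hη, sqrt_sq (norm_nonneg _)]
  have hw : ∀ w, ⟪w, capNormal ζ η⟫ =
      -((⟪w, ζ⟫ - ⟪ζ, η⟫ * ⟪w, η⟫) / √(1 - ⟪ζ, η⟫ ^ 2)) := fun w => by
    rw [capNormal, inner_neg_right, inner_smul_right, inner_sub_right, inner_smul_right, hn,
      inv_mul_eq_div]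
  refine ⟨?_, ?_, hw⟩
  · rw [capNormal, norm_neg, norm_smul, norm_inv, norm_norm, inv_mul_cancel₀]
    rw [hn]
    exact (sqrt_pos.2 hpos).ne'
  · rw [hw, real_inner_self_eq_norm_sq, hη, real_inner_comm]
    simp

/-- The explicit function is a Neumann Green function of the cap. -/
theorem isNeumannGreenFunction_cap (hζ : ‖ζ‖ = 1) (hρ : ρ ∈ Ioo (0 : ℝ) 2) :
    IsNeumannGreenFunction (sphericalCap ζ ρ) (capNormal ζ) (capNeumannGreen ζ ρ) := by
  have hρ0 : 0 < ρ := hρ.1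
  have hρ2 : 0 < 2 - ρ := sub_pos.2 hρ.2
  have hπ := pi_pos
  -- The constant absorbs the additive constant of G and the term log ř split off from the second
  -- logarithm.
  refine ⟨fun ξ => logComb (1 / (4 * π) * (1 - log 2) - 1 / (4 * π) * log (scalingFactor ζ ρ ξ))
    (-(1 / (4 * π))) (-((1 - ρ) / (2 * π * ρ))) (reflectionPoint ζ ρ ξ) (-ζ), ?_, ?_⟩
  · intro ξ hξ η hη hne
    have hξ1 := (mem_sphericalCap_iff.1 hξ).1
    have h1 : 1 - ⟪reflectionPoint ζ ρ ξ, η⟫ ≠ 0 :=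
      sub_ne_zero.2 (inner_reflectionPoint_ne_one hζ hρ hξ hη).symm
    simp only [capNeumannGreen, fundSol, logComb]
    rw [log_mul (scalingFactor_pos hζ hρ hξ1).ne' h1, inner_neg_left, sub_neg_eq_add]
    ring
  · intro ξ hξ
    obtain ⟨hξ1, hξ2⟩ := mem_sphericalCap_iff.1 hξ
    have hr := scalingFactor_pos hζ hρ hξ1
    have hb1 := norm_reflectionPoint hζ hρ hξ1
    have hb2 : ‖-ζ‖ = 1 := by rw [norm_neg, hζ]
    refine ⟨sphereContDiffOn_logComb
      (fun η hη => inner_reflectionPoint_ne_one hζ hρ hξ (subset_closure hη))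
      (fun η hη => inner_neg_ne_one hρ (subset_closure hη)), sphereContDiffOn_logComb
      (fun η hη => inner_reflectionPoint_ne_one hζ hρ hξ hη)
      (fun η hη => inner_neg_ne_one hρ hη), fun η hη => ?_, fun η hη => ?_⟩
    · rw [beltrami_logComb (mem_sphericalCap_iff.1 hη).1 hb1 hb2
        (inner_reflectionPoint_ne_one hζ hρ hξ (subset_closure hη))
        (inner_neg_ne_one hρ (subset_closure hη)), surfaceMeasure_sphericalCap hζ hρ]
      field_simp
      ring
    · have hηc : η ∈ closure (sphericalCap ζ ρ) := hη.1
      obtain ⟨hη1, hη2⟩ := of_mem_boundaryOf_sphericalCap hη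
      have hη0 : η ≠ 0 := by rintro rfl; simp at hη1
      have k1 := inner_reflectionPoint_ne_one hζ hρ hξ hηc
      have k2 := inner_neg_ne_one hρ hηc
      have k3 : ⟪ξ, η⟫ ≠ 1 := inner_ne_one_of_ne hξ1 hη1 fun h => hη.2 (h ▸ hξ)
      have hηη : ‖η‖⁻¹ • η = η := by rw [hη1, inv_one, one_smul]
      have hd : HasInnerNormalDeriv (capNormal ζ) (logComb (1 / (4 * π) * (1 - log 2) -
          1 / (4 * π) * log (scalingFactor ζ ρ ξ)) (-(1 / (4 * π))) (-((1 - ρ) / (2 * π * ρ)))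
          (reflectionPoint ζ ρ ξ) (-ζ)) η _ :=
        hasInnerNormalDeriv_of_contDiffAt
          (contDiffAt_logComb hη0 (by rwa [hηη]) (by rwa [hηη]))
      refine Eq.subst ?_ hd
      obtain ⟨n1, n2, n3⟩ := capNormal_spec hζ hη1 (by rw [hη2]; linarith) (by rw [hη2]; linarith)
      -- G is also a combination of this shape, with coefficient 0 at -ζ, so one gradient formula
      -- serves both sides.
      have hfs : (fun y => fundSol ⟪ξ, y⟫) =
          logComb (1 / (4 * π) * (1 - log 2)) (1 / (4 * π)) 0 ξ (-ζ) := by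
        funext y
        simp only [fundSol, logComb]
        ring
      unfold normalDeriv
      rw [hfs, inner_surfaceGradient_logComb hη1 n1 n2 hξ1 hb2 k3 k2,
        inner_surfaceGradient_logComb hη1 n1 n2 hb1 hb2 k1 k2]
      have e1 := scalingFactor_mul_inner hζ hρ hξ1 η
      have e2 := scalingFactor_mul_inner hζ hρ hξ1 (capNormal ζ η)
      -- Valid only on the boundary circle, where ζ·η = 1-ρ. It gives the two normal derivatives a
      -- common denominator.
      have e3 : 1 - ⟪ξ, η⟫ = scalingFactor ζ ρ ξ * (1 - ⟪reflectionPoint ζ ρ ξ, η⟫) := by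
        rw [mul_sub, e1, hη2, scalingFactor_eq]
        field_simp
        ring
      have e4 : ⟪reflectionPoint ζ ρ ξ, capNormal ζ η⟫ / (1 - ⟪reflectionPoint ζ ρ ξ, η⟫) =
          (⟪ξ, capNormal ζ η⟫ + 2 * (1 - ρ - ⟪ξ, ζ⟫) / (ρ * (2 - ρ)) * ⟪ζ, capNormal ζ η⟫) /
            (1 - ⟪ξ, η⟫) := by
        rw [← e2, e3, mul_div_mul_left _ _ hr.ne']
      have hk : 0 < 1 - (1 - ρ) ^ 2 := by nlinarith
      have hs := sqrt_pos.2 hk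
      have hsq : √(1 - (1 - ρ) ^ 2) ^ 2 = 1 - (1 - ρ) ^ 2 := sq_sqrt hk.le
      have k3' : 1 - ⟪ξ, η⟫ ≠ 0 := sub_ne_zero.2 k3.symm
      -- Here log(1 - ξ·η) + log(1 - ξ̌·η) has normal derivative 2(1-ρ)/√(1-(1-ρ)²), independent of
      -- ξ and η, and the term in log(1 + ζ·η) cancels it.
      rw [e4, inner_neg_left, inner_neg_left, n3 ξ, n3 ζ, real_inner_self_eq_norm_sq, hζ, hη2,
        show 1 - -(1 - ρ) = 2 - ρ by ring]
      field_simp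
      ring

end CapGeometry

/-! ### Boundary limits of the gradient -/

section BoundaryGradient

theorem isOpen_coneOver_sphericalCap (ζ : E3) (ρ : ℝ) : IsOpen (coneOver (sphericalCap ζ ρ)) := by
  have h : IsOpen ({x : E3 | x ≠ 0} ∩ (fun x => ⟪ζ, ‖x‖⁻¹ • x⟫) ⁻¹' Ioi (1 - ρ)) := by
    refine ContinuousOn.isOpen_inter_preimage ?_ isOpen_ne isOpen_Ioi
    exact continuousOn_const.inner
      ((continuous_norm.continuousOn.inv₀ fun x hx => norm_ne_zero_iff.2 hx).smul continuousOn_id)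
  convert h using 1
  ext x
  simp only [coneOver, mem_ofPred_eq, mem_sphericalCap_iff, mem_inter_iff, mem_preimage, mem_Ioi]
  refine and_congr_right fun hx => and_iff_right ?_
  rw [norm_smul, norm_inv, norm_norm, inv_mul_cancel₀ (norm_ne_zero_iff.2 hx)]

theorem mem_coneOver_of_norm_one {S : Set E3} {x : E3} (hx : ‖x‖ = 1) : x ∈ coneOver S ↔ x ∈ S := by
  simp only [coneOver, mem_ofPred_eq, hx, inv_one, one_smul, and_iff_right_iff_imp]
  rintro - rfl
  simp at hx

theorem coneOver_mono {S T : Set E3} (h : S ⊆ T) : coneOver S ⊆ coneOver T :=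
  fun _ hx => ⟨hx.1, h hx.2⟩

/-- Being C² within s provides a derivative f' near x that is continuous at x within s; on the open
set O it coincides with the Fréchet derivative. -/
theorem ContDiffWithinAt.exists_tendsto_fderiv {E : Type*} [NormedAddCommGroup E]
    [NormedSpace ℝ E] {f : E → ℝ} {s O : Set E} {x : E} (hf : ContDiffWithinAt ℝ 2 f s x)
    (hx : x ∈ s) (hO : IsOpen O) (hOs : O ⊆ s) :
    ∃ L : E →L[ℝ] ℝ, Tendsto (fderiv ℝ f) (𝓝[O] x) (𝓝 L) := by
  have h2 : (2 : WithTop ℕ∞) = 1 + 1 := by norm_num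
  rw [h2, contDiffWithinAt_succ_iff_hasFDerivWithinAt (by simp)] at hf
  obtain ⟨u, hu, -, f', hf', hc⟩ := hf
  rw [insert_eq_of_mem hx] at hu
  have hxu : x ∈ u := mem_of_mem_nhdsWithin hx hu
  obtain ⟨P, hP, hxP, hPu⟩ := mem_nhdsWithin.1 hu
  have hOu : O ∩ P ⊆ u := fun y hy => hPu ⟨hy.2, hOs hy.1⟩
  refine ⟨f' x, ?_⟩
  have h1 : Tendsto f' (𝓝[O] x) (𝓝 (f' x)) := by
    refine hc.continuousWithinAt.tendsto.mono_left ?_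
    rw [← nhdsWithin_inter_of_mem' (mem_nhdsWithin_of_mem_nhds (hP.mem_nhds hxP))]
    exact nhdsWithin_mono _ hOu
  refine h1.congr' ?_
  filter_upwards [self_mem_nhdsWithin, mem_nhdsWithin_of_mem_nhds (hP.mem_nhds hxP)] with y hy hyP
  have hyu : u ∈ 𝓝 y := mem_of_superset ((hO.inter hP).mem_nhds ⟨hy, hyP⟩) hOu
  exact ((hf' y (hOu ⟨hy, hyP⟩)).hasFDerivAt hyu).fderiv.symm

theorem eventually_inward_mem_coneOver {ζ η : E3} {ρ : ℝ} (hζ : ‖ζ‖ = 1) (hρ : ρ ∈ Ioo (0 : ℝ) 2)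
    (hη : η ∈ boundaryOf (sphericalCap ζ ρ)) : ∀ᶠ τ in 𝓝[>] (0 : ℝ),
      (√(1 + τ ^ 2))⁻¹ • (η - τ • capNormal ζ η) ∈ coneOver (sphericalCap ζ ρ) := by
  obtain ⟨hη1, hη2⟩ := of_mem_boundaryOf_sphericalCap hη
  have hρ0 := hρ.1
  have hρ2 := hρ.2
  obtain ⟨n1, n2, n3⟩ := capNormal_spec hζ hη1 (by rw [hη2]; linarith) (by rw [hη2]; linarith)
  have hk : 0 < 1 - (1 - ρ) ^ 2 := by nlinarith
  have hs := sqrt_pos.2 hk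
  have hν : ⟪ζ, capNormal ζ η⟫ = -√(1 - (1 - ρ) ^ 2) := by
    rw [n3, hη2, real_inner_self_eq_norm_sq, hζ, neg_inj, div_eq_iff hs.ne', mul_self_sqrt hk.le]
    ring
  filter_upwards [Ioo_mem_nhdsGT hs] with τ hτ
  have hq : 0 < 1 + τ ^ 2 := by positivity
  have hsq := sqrt_pos.2 hq
  have hnorm : ‖(√(1 + τ ^ 2))⁻¹ • (η - τ • capNormal ζ η)‖ = 1 := by
    have : ‖η - τ • capNormal ζ η‖ = √(1 + τ ^ 2) := by
      rw [eq_comm, sqrt_eq_iff_mul_self_eq hq.le (norm_nonneg _), ← sq, norm_sub_sq_real,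
        inner_smul_right, n2, norm_smul, n1, hη1, norm_eq_abs, mul_one, sq_abs]
      ring
    rw [norm_smul, this, norm_inv, norm_of_nonneg hsq.le, inv_mul_cancel₀ hsq.ne']
  rw [mem_coneOver_of_norm_one hnorm, mem_sphericalCap_iff]
  refine ⟨hnorm, ?_⟩
  rw [inner_smul_right, inner_sub_right, inner_smul_right, hη2, hν, inv_mul_eq_div,
    lt_div_iff₀ hsq]
  -- The inner product with ζ before normalisation is (1-ρ) + τ√(1-(1-ρ)²). Normalising costs at
  -- most √(1+τ²) - 1 ≤ τ², which is less than the gain for small τ.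
  have h1 : 1 ≤ √(1 + τ ^ 2) := one_le_sqrt.2 (by nlinarith [sq_nonneg τ])
  have h2 : √(1 + τ ^ 2) ≤ 1 + τ ^ 2 := by
    rw [sqrt_le_left (by positivity)]
    nlinarith [sq_nonneg τ, sq_nonneg (τ ^ 2)]
  have h3 : (1 - ρ) * (√(1 + τ ^ 2) - 1) ≤ 1 * (√(1 + τ ^ 2) - 1) := by
    apply mul_le_mul_of_nonneg_right <;> linarith
  have h4 : τ * τ < τ * √(1 - (1 - ρ) ^ 2) := mul_lt_mul_of_pos_left hτ.2 hτ.1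
  nlinarith

/-- At a boundary point of the cap the gradient of a function of class `C²` up to the boundary has
a limit, which determines the one-sided normal derivative. -/
theorem exists_tendsto_fderiv_radialExt {ζ η : E3} {ρ : ℝ} (hζ : ‖ζ‖ = 1) (hρ : ρ ∈ Ioo (0 : ℝ) 2)
    {U : E3 → ℝ} (hU : SphereContDiffOn 2 U (closure (sphericalCap ζ ρ)))
    (hη : η ∈ boundaryOf (sphericalCap ζ ρ)) {a : ℝ} (ha : HasInnerNormalDeriv (capNormal ζ) U η a) :
    ∃ L : E3 →L[ℝ] ℝ, Tendsto (fderiv ℝ (radialExt U)) (𝓝[coneOver (sphericalCap ζ ρ)] η) (𝓝 L) ∧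
      L (capNormal ζ η) = a := by
  obtain ⟨hη1, -⟩ := of_mem_boundaryOf_sphericalCap hη
  have hηc : η ∈ coneOver (closure (sphericalCap ζ ρ)) := (mem_coneOver_of_norm_one hη1).2 hη.1
  obtain ⟨L, hL⟩ := (hU η hηc).exists_tendsto_fderiv hηc (isOpen_coneOver_sphericalCap ζ ρ)
    (coneOver_mono subset_closure)
  refine ⟨L, hL, ?_⟩
  have h2 : Tendsto (fun τ : ℝ => (√(1 + τ ^ 2))⁻¹ • (η - τ • capNormal ζ η)) (𝓝[>] 0)
      (𝓝[coneOver (sphericalCap ζ ρ)] η) := by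
    refine tendsto_nhdsWithin_iff.2 ⟨?_, eventually_inward_mem_coneOver hζ hρ hη⟩
    have : Continuous fun τ : ℝ => (√(1 + τ ^ 2))⁻¹ • (η - τ • capNormal ζ η) :=
      Continuous.smul (Continuous.inv₀ (by fun_prop) fun τ => (sqrt_pos.2 (by positivity)).ne')
        (by fun_prop)
    have h := this.tendsto 0
    simp only [ne_eq, OfNat.ofNat_ne_zero, not_false_eq_true, zero_pow, add_zero, sqrt_one, inv_one,
      zero_smul, sub_zero, one_smul] at h
    exact h.mono_left nhdsWithin_le_nhds
  have h3 := ((ContinuousLinearMap.apply ℝ ℝ (capNormal ζ η)).continuous.tendsto _).comp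
    (hL.comp h2)
  unfold HasInnerNormalDeriv at ha
  simp only [inner_surfaceGradient] at ha
  exact tendsto_nhds_unique h3 ha

end BoundaryGradient

/-! ### The stereographic chart about the centre of the cap -/

section CapChart

variable (b : OrthonormalBasis (Fin 3) ℝ E3)

/-- The stereographic chart of the sphere centred at the first vector of an orthonormal basis. -/
noncomputable def chart (z : ℂ) : E3 := stereo (b 0) (b 1) (b 2) z.re z.im

theorem one_add_normSq (z : ℂ) : 1 + z.re ^ 2 + z.im ^ 2 = 1 + ‖z‖ ^ 2 := by
  rw [← Complex.normSq_eq_norm_sq, Complex.normSq_apply]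
  ring

theorem norm_chart (z : ℂ) : ‖chart b z‖ = 1 := norm_stereo (orthonormal_frame b) _ _

theorem contDiff_chart : ContDiff ℝ 2 (chart b) := contDiff_stereo _ _ _

theorem inner_chart (z : ℂ) : ⟪b 0, chart b z⟫ = (1 - ‖z‖ ^ 2) / (1 + ‖z‖ ^ 2) := by
  rw [chart, stereo, inner_frame_fst (orthonormal_frame b), one_add_normSq, sub_sub]
  congr 2
  linarith [one_add_normSq z]

theorem exists_chart_eq {η : E3} (hη : ‖η‖ = 1) (h : -1 < ⟪b 0, η⟫) : ∃ z, chart b z = η := by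
  have hsum : ⟪b 0, η⟫ ^ 2 + ⟪b 1, η⟫ ^ 2 + ⟪b 2, η⟫ ^ 2 = 1 := by
    have := b.sum_sq_norm_inner_right η
    simpa [Fin.sum_univ_three, hη] using this
  have h1 : 1 + ⟪b 0, η⟫ ≠ 0 := by linarith
  refine ⟨⟨⟪b 1, η⟫ / (1 + ⟪b 0, η⟫), ⟪b 2, η⟫ / (1 + ⟪b 0, η⟫)⟩, ?_⟩
  conv_rhs => rw [eq_frame_inner b η]
  have hq : 1 + (⟪b 1, η⟫ / (1 + ⟪b 0, η⟫)) ^ 2 + (⟪b 2, η⟫ / (1 + ⟪b 0, η⟫)) ^ 2 =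
      2 / (1 + ⟪b 0, η⟫) := by
    field_simp
    linear_combination hsum
  simp only [chart, stereo, hq]
  congr 1
  · rw [sub_sub, show (1 : ℝ) - ((⟪b 1, η⟫ / (1 + ⟪b 0, η⟫)) ^ 2 + (⟪b 2, η⟫ / (1 + ⟪b 0, η⟫)) ^ 2)
      = 2 - 2 / (1 + ⟪b 0, η⟫) by linarith]
    field_simp
    ring
  · field_simp
  · field_simp

/-- The Euler field r∂_r is carried to the meridian field, a positive multiple of the outward normal
on a boundary circle; this links the radial to the normal derivative. -/
theorem fderiv_chart_apply_self (z : ℂ) :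
    fderiv ℝ (chart b) z z = -(b 0 - ⟪b 0, chart b z⟫ • chart b z) := by
  have hd := ((contDiff_chart b).differentiable two_ne_zero z).hasFDerivAt
  have hγ : HasDerivAt (fun t : ℝ => z + t • z) z 0 := by
    simpa using ((hasDerivAt_id (0 : ℝ)).smul_const z).const_add z
  have hd' : HasFDerivAt (chart b) (fderiv ℝ (chart b) z) (z + (0 : ℝ) • z) := by simpa using hd
  have h1 := hd'.comp_hasDerivAt 0 hγ
  have hq := (one_add_sq_add_sq_pos z.re z.im).ne'
  have k1 : ∀ x : ℝ, HasDerivAt (fun t : ℝ => x + t * x) x 0 := fun x => by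
    simpa using ((hasDerivAt_id' (0 : ℝ)).mul_const x).const_add x
  have k2 : ∀ x : ℝ, HasDerivAt (fun t : ℝ => (x + t * x) ^ 2) (2 * x ^ 2) 0 := fun x => by
    refine ((k1 x).fun_pow 2).congr_deriv ?_
    norm_num
    ring
  have kq := ((k2 z.re).const_add 1).fun_add (k2 z.im)
  have hq0 : (1 : ℝ) + (z.re + 0 * z.re) ^ 2 + (z.im + 0 * z.im) ^ 2 ≠ 0 := by simpa using hq
  have h2 := hasDerivAt_frame (b 0) (b 1) (b 2)
    ((((k2 z.re).const_sub 1).fun_sub (k2 z.im)).fun_div kq hq0)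
    (((k1 z.re).const_mul 2).fun_div kq hq0) (((k1 z.im).const_mul 2).fun_div kq hq0)
  have h3 : (chart b ∘ fun t : ℝ => z + t • z) = fun t : ℝ => frame (b 0) (b 1) (b 2)
      ((1 - (z.re + t * z.re) ^ 2 - (z.im + t * z.im) ^ 2) /
        (1 + (z.re + t * z.re) ^ 2 + (z.im + t * z.im) ^ 2))
      (2 * (z.re + t * z.re) / (1 + (z.re + t * z.re) ^ 2 + (z.im + t * z.im) ^ 2))
      (2 * (z.im + t * z.im) / (1 + (z.re + t * z.re) ^ 2 + (z.im + t * z.im) ^ 2)) := by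
    funext t
    simp [chart, stereo]
  rw [h3] at h1
  rw [h1.unique h2, chart, stereo, inner_frame_fst (orthonormal_frame b)]
  simp only [frame, zero_mul, add_zero]
  match_scalars
  · field_simp
    ring
  · field_simp
    ring
  · field_simp
    ring

/-- The chordal distance formula. After taking logarithms, the spherical kernel is the planar one
plus terms depending on each point separately. -/
theorem one_sub_inner_chart (z w : ℂ) : 1 - ⟪chart b z, chart b w⟫ =
    2 * ‖z - w‖ ^ 2 / ((1 + ‖z‖ ^ 2) * (1 + ‖w‖ ^ 2)) := by
  have h1 := one_add_sq_add_sq_pos z.re z.im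
  have h2 := one_add_sq_add_sq_pos w.re w.im
  have h3 : ‖z - w‖ ^ 2 = (z.re - w.re) ^ 2 + (z.im - w.im) ^ 2 := by
    have := one_add_normSq (z - w)
    simp only [Complex.sub_re, Complex.sub_im] at this
    linarith
  rw [chart, chart, stereo, stereo, inner_frame (orthonormal_frame b), ← one_add_normSq,
    ← one_add_normSq, h3]
  field_simp
  ring

theorem rotate_chart (θ : ℝ) (z : ℂ) :
    rotate b θ (chart b z) = chart b (circleMap 0 ‖z‖ (θ + z.arg)) := by
  have hz : circleMap 0 ‖z‖ (θ + z.arg) = circleMap 0 1 θ * z := by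
    have := Complex.norm_mul_exp_arg_mul_I z
    simp only [circleMap, zero_add, Complex.ofReal_add, add_mul, Complex.exp_add]
    nth_rw 3 [← this]
    push_cast
    ring
  have h1 := circleMap_zero_one_re_im 1 θ
  rw [hz, chart, rotate_stereo, chart, Complex.mul_re, Complex.mul_im, h1.1, h1.2, one_mul, one_mul]
  congr 1
  ring

end CapChart

/-! ### The cap and its boundary circle in the chart -/

section CapChartImages

open Metric

variable (b : OrthonormalBasis (Fin 3) ℝ E3) {ρ : ℝ}

/-- The radius of the disc which the stereographic chart maps onto the cap. -/
noncomputable def capRadius (ρ : ℝ) : ℝ := √(ρ / (2 - ρ))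

theorem capRadius_pos (hρ : ρ ∈ Ioo (0 : ℝ) 2) : 0 < capRadius ρ :=
  sqrt_pos.2 (div_pos hρ.1 (sub_pos.2 hρ.2))

theorem capRadius_sq (hρ : ρ ∈ Ioo (0 : ℝ) 2) : capRadius ρ ^ 2 = ρ / (2 - ρ) :=
  sq_sqrt (div_pos hρ.1 (sub_pos.2 hρ.2)).le

theorem chart_mem_sphericalCap_iff (hρ : ρ ∈ Ioo (0 : ℝ) 2) (z : ℂ) :
    chart b z ∈ sphericalCap (b 0) ρ ↔ z ∈ ball (0 : ℂ) (capRadius ρ) := by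
  have h2 : 0 < 2 - ρ := sub_pos.2 hρ.2
  have hq : 0 < 1 + ‖z‖ ^ 2 := by positivity
  rw [mem_sphericalCap_iff, and_iff_right (norm_chart b z), inner_chart, lt_div_iff₀ hq,
    mem_ball_zero_iff, ← sq_lt_sq₀ (norm_nonneg _) (capRadius_pos hρ).le, capRadius_sq hρ,
    lt_div_iff₀ h2]
  constructor <;> intro h <;> linarith

theorem chart_mem_closure_sphericalCap (hρ : ρ ∈ Ioo (0 : ℝ) 2) {z : ℂ}
    (hz : z ∈ closedBall (0 : ℂ) (capRadius ρ)) : chart b z ∈ closure (sphericalCap (b 0) ρ) := by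
  rw [← closure_ball _ (capRadius_pos hρ).ne'] at hz
  refine map_mem_closure (contDiff_chart b).continuous hz fun w hw => ?_
  exact (chart_mem_sphericalCap_iff b hρ w).2 hw

theorem chart_mem_boundaryOf_sphericalCap (hρ : ρ ∈ Ioo (0 : ℝ) 2) {z : ℂ}
    (hz : z ∈ sphere (0 : ℂ) (capRadius ρ)) : chart b z ∈ boundaryOf (sphericalCap (b 0) ρ) := by
  refine ⟨chart_mem_closure_sphericalCap b hρ (sphere_subset_closedBall hz), fun h => ?_⟩
  rw [chart_mem_sphericalCap_iff b hρ, mem_ball_zero_iff] at h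
  rw [mem_sphere_zero_iff_norm] at hz
  exact h.ne hz

/-- The isometric parametrization of a parallel circle plane. -/
noncomputable def parallelMap (a : ℝ) (z : ℂ) : E3 := frame (b 0) (b 1) (b 2) a z.re z.im

theorem isometry_parallelMap (a : ℝ) : Isometry (parallelMap b a) := by
  refine Isometry.of_dist_eq fun z w => ?_
  have h : parallelMap b a z - parallelMap b a w =
      frame (b 0) (b 1) (b 2) 0 (z - w).re (z - w).im := by
    simp only [parallelMap, frame, Complex.sub_re, Complex.sub_im]
    module
  rw [dist_eq_norm, dist_eq_norm, h, ← sq_eq_sq₀ (norm_nonneg _) (norm_nonneg _),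
    norm_sq_frame (orthonormal_frame b)]
  linarith [one_add_normSq (z - w)]

/-- The conformal factor is constant on the circle, with 2/(1+|z|²) = 2-ρ, so the chart acts there
as a dilation followed by an isometry. Arc length thus transfers from the plane. -/
theorem chart_eq_parallelMap (hρ : ρ ∈ Ioo (0 : ℝ) 2) {z : ℂ}
    (hz : z ∈ sphere (0 : ℂ) (capRadius ρ)) :
    chart b z = parallelMap b (1 - ρ) (((2 - ρ : ℝ) : ℂ) * z) := by
  have h2 : 2 - ρ ≠ 0 := (sub_pos.2 hρ.2).ne'
  rw [mem_sphere_zero_iff_norm] at hz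
  have hq : 1 + z.re ^ 2 + z.im ^ 2 = 2 / (2 - ρ) := by
    rw [one_add_normSq, hz, capRadius_sq hρ]
    field_simp
    ring
  rw [chart, stereo, parallelMap, hq, Complex.re_ofReal_mul, Complex.im_ofReal_mul, sub_sub,
    show (1 : ℝ) - (z.re ^ 2 + z.im ^ 2) = 2 - 2 / (2 - ρ) by linarith]
  congr 1
  · field_simp
    ring
  · field_simp
  · field_simp

/-- The radius of the boundary circle of a cap. -/
noncomputable def boundaryRadius (ρ : ℝ) : ℝ := (2 - ρ) * capRadius ρ

theorem boundaryRadius_pos (hρ : ρ ∈ Ioo (0 : ℝ) 2) : 0 < boundaryRadius ρ :=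
  mul_pos (sub_pos.2 hρ.2) (capRadius_pos hρ)

theorem boundaryRadius_sq (hρ : ρ ∈ Ioo (0 : ℝ) 2) : boundaryRadius ρ ^ 2 = 1 - (1 - ρ) ^ 2 := by
  have h2 : 2 - ρ ≠ 0 := (sub_pos.2 hρ.2).ne'
  rw [boundaryRadius, mul_pow, capRadius_sq hρ]
  field_simp
  ring

theorem boundaryOf_sphericalCap (hρ : ρ ∈ Ioo (0 : ℝ) 2) :
    boundaryOf (sphericalCap (b 0) ρ) =
      parallelMap b (1 - ρ) '' sphere (0 : ℂ) (boundaryRadius ρ) := by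
  have h2 : 0 < 2 - ρ := sub_pos.2 hρ.2
  refine Subset.antisymm (fun η hη => ?_) ?_
  · obtain ⟨h1, h3⟩ := of_mem_boundaryOf_sphericalCap hη
    refine ⟨⟨⟪b 1, η⟫, ⟪b 2, η⟫⟩, ?_, ?_⟩
    · rw [mem_sphere_zero_iff_norm, ← sq_eq_sq₀ (norm_nonneg _) (boundaryRadius_pos hρ).le,
        boundaryRadius_sq hρ, ← h3]
      have hsum : ⟪b 0, η⟫ ^ 2 + ⟪b 1, η⟫ ^ 2 + ⟪b 2, η⟫ ^ 2 = 1 := by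
        have := b.sum_sq_norm_inner_right η
        simpa [Fin.sum_univ_three, h1] using this
      have := one_add_normSq ⟨⟪b 1, η⟫, ⟪b 2, η⟫⟩
      simp only at this
      linarith
    · conv_rhs => rw [eq_frame_inner b η, h3]
      rfl
  · rintro _ ⟨w, hw, rfl⟩
    have hw' : ((2 - ρ : ℝ) : ℂ)⁻¹ * w ∈ sphere (0 : ℂ) (capRadius ρ) := by
      rw [mem_sphere_zero_iff_norm] at hw ⊢
      rw [norm_mul, hw, norm_inv, Complex.norm_real, norm_of_nonneg h2.le, boundaryRadius,
        inv_mul_cancel_left₀ h2.ne']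
    have := chart_mem_boundaryOf_sphericalCap b hρ hw'
    rwa [chart_eq_parallelMap b hρ hw', mul_inv_cancel_left₀ (by exact_mod_cast h2.ne')] at this

/-- Line integrals over the boundary of the cap in the stereographic chart. -/
theorem integral_boundaryOf_sphericalCap (hρ : ρ ∈ Ioo (0 : ℝ) 2) {g : E3 → ℝ}
    (hg : ContinuousOn g (boundaryOf (sphericalCap (b 0) ρ))) :
    ∫ η in boundaryOf (sphericalCap (b 0) ρ), g η ∂lineMeasure =
      2 * π * boundaryRadius ρ * circleAverage (fun z => g (chart b z)) 0 (capRadius ρ) := by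
  have hR := capRadius_pos hρ
  rw [boundaryOf_sphericalCap b hρ] at hg ⊢
  rw [integral_hausdorffMeasure_image_circle (boundaryRadius_pos hρ) (isometry_parallelMap b _) hg]
  congr 1
  unfold circleAverage
  congr 1
  refine intervalIntegral.integral_congr fun θ _ => ?_
  simp only
  rw [chart_eq_parallelMap b hρ (circleMap_mem_sphere 0 hR.le θ)]
  congr 2
  simp only [circleMap, zero_add, boundaryRadius]
  push_cast
  ring

end CapChartImages

/-! ### Representation of Neumann solutions -/

section NeumannSolution

open Metric InnerProductSpace

variable {b : OrthonormalBasis (Fin 3) ℝ E3} {ρ : ℝ} {F U : E3 → ℝ}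

theorem contDiffAt_radialExt_chart (hρ : ρ ∈ Ioo (0 : ℝ) 2)
    (hU : SphereContDiffOn 2 U (sphericalCap (b 0) ρ)) {z : ℂ}
    (hz : z ∈ ball (0 : ℂ) (capRadius ρ)) : ContDiffAt ℝ 2 (radialExt U) (chart b z) := by
  have h : chart b z ∈ coneOver (sphericalCap (b 0) ρ) :=
    (mem_coneOver_of_norm_one (norm_chart b z)).2 ((chart_mem_sphericalCap_iff b hρ z).2 hz)
  exact (hU _ h).contDiffAt ((isOpen_coneOver_sphericalCap _ _).mem_nhds h)

theorem harmonicOnNhd_comp_chart (hρ : ρ ∈ Ioo (0 : ℝ) 2)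
    (hU : SphereContDiffOn 2 U (sphericalCap (b 0) ρ))
    (hharm : ∀ ξ ∈ sphericalCap (b 0) ρ, beltrami U ξ = 0) :
    HarmonicOnNhd (fun z => radialExt U (chart b z)) (ball 0 (capRadius ρ)) := by
  intro z hz
  refine ⟨ContDiffAt.comp (g := radialExt U) z (contDiffAt_radialExt_chart hρ hU hz)
    (contDiff_chart b).contDiffAt, ?_⟩
  filter_upwards [isOpen_ball.mem_nhds hz] with w hw
  have := laplacian_comp_stereo (orthonormal_frame b) U w (contDiffAt_radialExt_chart hρ hU hw)
  have h0 : beltrami U (stereo (b 0) (b 1) (b 2) w.re w.im) = 0 :=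
    hharm _ ((chart_mem_sphericalCap_iff b hρ w).2 hw)
  rw [h0, mul_zero] at this
  exact this

/-- A parallel circle is a circle about 0 in the chart, so the planar mean value property applies,
always with the value at the centre. -/
theorem integral_rotate_chart (hρ : ρ ∈ Ioo (0 : ℝ) 2)
    (hu : HarmonicOnNhd (fun z => radialExt U (chart b z)) (ball 0 (capRadius ρ)))
    {η : E3} (hη : η ∈ sphericalCap (b 0) ρ) :
    ∫ θ in (0 : ℝ)..2 * π, U (rotate b θ η) = 2 * π * radialExt U (chart b 0) := by
  obtain ⟨h1, h2⟩ := mem_sphericalCap_iff.1 hη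
  obtain ⟨z, rfl⟩ := exists_chart_eq b h1 (by linarith [hρ.2])
  rw [chart_mem_sphericalCap_iff b hρ, mem_ball_zero_iff] at hη
  have h := InnerProductSpace.HarmonicOnNhd.circleAverage_eq (c := 0) (R := ‖z‖) (hu.mono (by
    rw [abs_norm]
    exact closedBall_subset_ball hη))
  rw [circleAverage_eq_integral_add z.arg, smul_eq_mul, inv_mul_eq_iff_eq_mul₀ two_pi_pos.ne'] at h
  rw [← h]
  refine intervalIntegral.integral_congr fun θ _ => ?_
  simp only [rotate_chart, radialExt_of_norm_one U (norm_chart b _)]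

theorem integral_sphericalCap_eq (hρ : ρ ∈ Ioo (0 : ℝ) 2)
    (hUc : ContinuousOn U (closure (sphericalCap (b 0) ρ)))
    (hu : HarmonicOnNhd (fun z => radialExt U (chart b z)) (ball 0 (capRadius ρ))) :
    1 / (2 * π * ρ) * ∫ η in sphericalCap (b 0) ρ, U η ∂surfaceMeasure =
      radialExt U (chart b 0) := by
  rw [integral_sphericalCap_of_rotate_average b hUc fun η hη => integral_rotate_chart hρ hu hη,
    surfaceMeasure_sphericalCap (b.orthonormal.1 0) hρ]
  have := hρ.1.ne'
  have := pi_pos.ne'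
  field_simp

open Classical in
/-- The radial derivative `r ∂_r` of a Neumann solution in the stereographic chart, extended to the
boundary circle by the Neumann data. -/
noncomputable def radialDeriv (b : OrthonormalBasis (Fin 3) ℝ E3) (ρ : ℝ) (F U : E3 → ℝ) (z : ℂ) :
    ℝ :=
  if z ∈ ball (0 : ℂ) (capRadius ρ) then fderiv ℝ (fun z => radialExt U (chart b z)) z z
  else boundaryRadius ρ * F (chart b z)

theorem radialDeriv_of_mem_ball (hρ : ρ ∈ Ioo (0 : ℝ) 2)
    (hU : SphereContDiffOn 2 U (sphericalCap (b 0) ρ)) {z : ℂ}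
    (hz : z ∈ ball (0 : ℂ) (capRadius ρ)) :
    radialDeriv b ρ F U z =
      fderiv ℝ (radialExt U) (chart b z) (-(b 0 - ⟪b 0, chart b z⟫ • chart b z)) := by
  have h1 : DifferentiableAt ℝ (radialExt U) (chart b z) :=
    (contDiffAt_radialExt_chart hρ hU hz).differentiableAt two_ne_zero
  have h2 : DifferentiableAt ℝ (chart b) z := (contDiff_chart b).differentiable two_ne_zero z
  have h3 := fderiv_fun_comp z h1 h2
  rw [radialDeriv, if_pos hz, h3, ContinuousLinearMap.comp_apply, fderiv_chart_apply_self]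

theorem radialDeriv_of_mem_sphere {z : ℂ} (hz : z ∈ sphere (0 : ℂ) (capRadius ρ)) :
    radialDeriv b ρ F U z = boundaryRadius ρ * F (chart b z) := by
  rw [radialDeriv, if_neg]
  rw [mem_ball, not_lt]
  exact (mem_sphere.1 hz).ge

theorem continuous_tangential_chart (b : OrthonormalBasis (Fin 3) ℝ E3) :
    Continuous fun z => -(b 0 - ⟪b 0, chart b z⟫ • chart b z) := by
  have hn : Continuous (chart b) := (contDiff_chart b).continuous
  fun_prop

theorem continuousAt_radialDeriv (hρ : ρ ∈ Ioo (0 : ℝ) 2)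
    (hU : SphereContDiffOn 2 U (sphericalCap (b 0) ρ)) {z : ℂ}
    (hz : z ∈ ball (0 : ℂ) (capRadius ρ)) : ContinuousAt (radialDeriv b ρ F U) z := by
  have h1 : ContinuousAt (fderiv ℝ (radialExt U)) (chart b z) :=
    (contDiffAt_radialExt_chart hρ hU hz).continuousAt_fderiv two_ne_zero
  have h2 : ContinuousAt (fun z => fderiv ℝ (radialExt U) (chart b z)) z :=
    ContinuousAt.comp (g := fderiv ℝ (radialExt U)) h1 (contDiff_chart b).continuous.continuousAt
  refine (h2.clm_apply (continuous_tangential_chart b).continuousAt).congr ?_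
  filter_upwards [isOpen_ball.mem_nhds hz] with w hw using (radialDeriv_of_mem_ball hρ hU hw).symm

theorem tendsto_radialDeriv (hρ : ρ ∈ Ioo (0 : ℝ) 2)
    (hU : SphereContDiffOn 2 U (closure (sphericalCap (b 0) ρ)))
    (hsol : IsNeumannSolution (sphericalCap (b 0) ρ) (capNormal (b 0)) F U) {z : ℂ}
    (hz : z ∈ sphere (0 : ℂ) (capRadius ρ)) :
    Tendsto (radialDeriv b ρ F U) (𝓝[ball 0 (capRadius ρ)] z) (𝓝 (radialDeriv b ρ F U z)) := by
  have hn : Continuous (chart b) := (contDiff_chart b).continuous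
  have hb0 : ‖b 0‖ = 1 := b.orthonormal.1 0
  have hzbd := chart_mem_boundaryOf_sphericalCap b hρ hz
  obtain ⟨L, hL, hLF⟩ := exists_tendsto_fderiv_radialExt hb0 hρ hU hzbd (hsol.normal _ hzbd)
  have h1 : Tendsto (chart b) (𝓝[ball 0 (capRadius ρ)] z)
      (𝓝[coneOver (sphericalCap (b 0) ρ)] chart b z) := by
    refine tendsto_nhdsWithin_iff.2 ⟨hn.continuousAt.tendsto.mono_left nhdsWithin_le_nhds, ?_⟩
    filter_upwards [self_mem_nhdsWithin] with w hw
    exact (mem_coneOver_of_norm_one (norm_chart b w)).2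
      ((chart_mem_sphericalCap_iff b hρ w).2 hw)
  have h2 : Tendsto (fun w => fderiv ℝ (radialExt U) (chart b w)) (𝓝[ball 0 (capRadius ρ)] z)
      (𝓝 L) := hL.comp h1
  have h3 := ((continuous_tangential_chart b).tendsto z).mono_left
    (nhdsWithin_le_nhds (s := ball 0 (capRadius ρ)))
  have h4 : Tendsto (fun w => fderiv ℝ (radialExt U) (chart b w)
      (-(b 0 - ⟪b 0, chart b w⟫ • chart b w))) (𝓝[ball 0 (capRadius ρ)] z)
      (𝓝 (L (-(b 0 - ⟪b 0, chart b z⟫ • chart b z)))) :=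
    ((isBoundedBilinearMap_apply (𝕜 := ℝ) (E := E3) (F := ℝ)).continuous.tendsto (L, _)).comp
      (h2.prodMk_nhds h3)
  -- On the boundary the meridian field has length `boundaryRadius ρ`, so it is that multiple of the
  -- unit normal, and L of the normal is F.
  have hlim : L (-(b 0 - ⟪b 0, chart b z⟫ • chart b z)) = radialDeriv b ρ F U z := by
    obtain ⟨-, hzz⟩ := of_mem_boundaryOf_sphericalCap hzbd
    have hnorm : ‖b 0 - ⟪b 0, chart b z⟫ • chart b z‖ = boundaryRadius ρ := by
      rw [← sq_eq_sq₀ (norm_nonneg _) (boundaryRadius_pos hρ).le,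
        norm_sq_tangential hb0 (norm_chart b z), boundaryRadius_sq hρ, hzz]
    rw [radialDeriv_of_mem_sphere hz, ← hLF, capNormal, ← smul_neg, map_smul, hnorm, smul_eq_mul,
      mul_inv_cancel_left₀ (boundaryRadius_pos hρ).ne']
  rw [hlim] at h4
  refine h4.congr' ?_
  filter_upwards [self_mem_nhdsWithin] with w hw using
    (radialDeriv_of_mem_ball hρ hsol.contDiffOn hw).symm

theorem continuousOn_radialDeriv (hρ : ρ ∈ Ioo (0 : ℝ) 2)
    (hF : ContinuousOn F (boundaryOf (sphericalCap (b 0) ρ)))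
    (hU : SphereContDiffOn 2 U (closure (sphericalCap (b 0) ρ)))
    (hsol : IsNeumannSolution (sphericalCap (b 0) ρ) (capNormal (b 0)) F U) :
    ContinuousOn (radialDeriv b ρ F U) (closedBall 0 (capRadius ρ)) := by
  intro z hz
  by_cases hzb : z ∈ ball (0 : ℂ) (capRadius ρ)
  · exact (continuousAt_radialDeriv hρ hsol.contDiffOn hzb).continuousWithinAt
  · have hzs : z ∈ sphere (0 : ℂ) (capRadius ρ) := by
      rw [mem_sphere]
      exact le_antisymm hz (not_lt.1 hzb)
    rw [ContinuousWithinAt, ← ball_union_sphere, nhdsWithin_union, tendsto_sup]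
    refine ⟨tendsto_radialDeriv hρ hU hsol hzs, ?_⟩
    have h1 : ContinuousOn (fun w => boundaryRadius ρ * F (chart b w))
        (sphere (0 : ℂ) (capRadius ρ)) :=
      continuousOn_const.mul (hF.comp (contDiff_chart b).continuous.continuousOn
        fun w hw => chart_mem_boundaryOf_sphericalCap b hρ hw)
    exact (h1.congr fun w hw => radialDeriv_of_mem_sphere hw) z hzs

/-- The constant c is arbitrary because the Neumann data have zero integral, a consequence of V
having average 0. -/
theorem neumannSolution_representation (hρ : ρ ∈ Ioo (0 : ℝ) 2)
    (hF : ContinuousOn F (boundaryOf (sphericalCap (b 0) ρ)))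
    (hU : SphereContDiffOn 2 U (closure (sphericalCap (b 0) ρ)))
    (hsol : IsNeumannSolution (sphericalCap (b 0) ρ) (capNormal (b 0)) F U)
    {ξ : E3} (hξ : ξ ∈ sphericalCap (b 0) ρ) (c : ℝ) :
    U ξ = 1 / (2 * π * ρ) * (∫ η in sphericalCap (b 0) ρ, U η ∂surfaceMeasure) -
      ∫ η in boundaryOf (sphericalCap (b 0) ρ), (1 / (2 * π) * log (1 - ⟪ξ, η⟫) + c) * F η
        ∂lineMeasure := by
  have hR := capRadius_pos hρ
  have hu := harmonicOnNhd_comp_chart hρ hsol.contDiffOn hsol.harmonic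
  rw [integral_sphericalCap_eq hρ hsol.continuousOn hu]
  obtain ⟨h1, h2⟩ := mem_sphericalCap_iff.1 hξ
  obtain ⟨z₀, rfl⟩ := exists_chart_eq b h1 (by linarith [hρ.2])
  have hz₀ : ‖z₀‖ < capRadius ρ :=
    mem_ball_zero_iff.1 ((chart_mem_sphericalCap_iff b hρ z₀).1 hξ)
  have hV := continuousOn_radialDeriv hρ hF hU hsol
  obtain ⟨hD, h0⟩ := HarmonicOnNhd.sub_eq_circleAverage_log hu hV
    (fun z hz => by rw [radialDeriv, if_pos hz]) hz₀
  have hne : ∀ η ∈ boundaryOf (sphericalCap (b 0) ρ), 1 - ⟪chart b z₀, η⟫ ≠ 0 := fun η hη =>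
    sub_ne_zero.2 (inner_ne_one_of_ne h1 (of_mem_boundaryOf_sphericalCap hη).1
      fun h => hη.2 (h ▸ hξ)).symm
  have hg : ContinuousOn (fun η => (1 / (2 * π) * log (1 - ⟪chart b z₀, η⟫) + c) * F η)
      (boundaryOf (sphericalCap (b 0) ρ)) :=
    ((continuousOn_const.mul ((continuousOn_const.sub (by fun_prop)).log hne)).add
      continuousOn_const).mul hF
  rw [integral_boundaryOf_sphericalCap b hρ hg]
  -- Everything in the kernel that is constant along the boundary circle, after the factor 2π is
  -- absorbed. It multiplies the average of V, which is 0.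
  set κ := log 2 - log (1 + ‖z₀‖ ^ 2) - log (1 + capRadius ρ ^ 2) + 2 * π * c with hκ
  set V := radialDeriv b ρ F U with hVdef
  have hVs : ContinuousOn V (sphere 0 (capRadius ρ)) := hV.mono sphere_subset_closedBall
  have i1 : CircleIntegrable (fun z => log ‖z₀ - z‖ * V z) 0 (capRadius ρ) := by
    refine ContinuousOn.circleIntegrable hR.le ((continuousOn_log_norm_sub_mul (z₀ := z₀) hV).mono
      fun z hz => ?_)
    rw [mem_sphere_zero_iff_norm] at hz
    simp [hz, hz₀]
  have i2 : CircleIntegrable V 0 (capRadius ρ) := hVs.circleIntegrable hR.le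
  have i3 : CircleIntegrable (fun z => (2 : ℝ) • (log ‖z₀ - z‖ * V z)) 0 (capRadius ρ) :=
    i1.const_smul
  have i4 : CircleIntegrable (fun z => κ • V z) 0 (capRadius ρ) := i2.const_smul
  have key : 2 * π * boundaryRadius ρ * circleAverage (fun z => (1 / (2 * π) *
      log (1 - ⟪chart b z₀, chart b z⟫) + c) * F (chart b z)) 0 (capRadius ρ) =
      circleAverage (fun z => (2 : ℝ) • (log ‖z₀ - z‖ * V z) + κ • V z) 0 (capRadius ρ) := by
    rw [← smul_eq_mul (2 * π * boundaryRadius ρ), ← circleAverage_fun_smul]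
    refine circleAverage_congr_sphere fun z hz => ?_
    rw [abs_of_pos hR] at hz
    have hzn : ‖z‖ = capRadius ρ := mem_sphere_zero_iff_norm.1 hz
    have hVz : V z = boundaryRadius ρ * F (chart b z) := radialDeriv_of_mem_sphere hz
    have hzz : ‖z₀ - z‖ ≠ 0 := by
      rw [norm_ne_zero_iff, sub_ne_zero]
      rintro rfl
      exact hz₀.ne hzn
    have hlog : log (1 - ⟪chart b z₀, chart b z⟫) =
        log 2 + 2 * log ‖z₀ - z‖ - (log (1 + ‖z₀‖ ^ 2) + log (1 + capRadius ρ ^ 2)) := by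
      have p1 : 1 + ‖z₀‖ ^ 2 ≠ 0 := by positivity
      have p2 : 1 + capRadius ρ ^ 2 ≠ 0 := by positivity
      rw [one_sub_inner_chart, hzn, log_div (mul_ne_zero two_ne_zero (pow_ne_zero 2 hzz))
        (mul_ne_zero p1 p2), log_mul two_ne_zero (pow_ne_zero 2 hzz), log_mul p1 p2, log_pow]
      push_cast
      ring
    have hπ := pi_pos.ne'
    simp only [smul_eq_mul, hlog, hVz, hκ]
    field_simp
    ring
  rw [key, circleAverage_fun_add i3 i4, circleAverage_fun_smul, circleAverage_fun_smul, h0,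
    ← radialExt_of_norm_one U h1]
  simp only [smul_eq_mul]
  linarith

end NeumannSolution

theorem mainTheorem7 (ζ : E3) (hζ : ζ ∈ unitSphere) (ρ : ℝ) (hρ : ρ ∈ Set.Ioo (0 : ℝ) 2) :
    IsNeumannGreenFunction (sphericalCap ζ ρ) (capNormal ζ) (capNeumannGreen ζ ρ) ∧
    ∀ F U : E3 → ℝ,
      ContinuousOn F (boundaryOf (sphericalCap ζ ρ)) →
      SphereContDiffOn 2 U (closure (sphericalCap ζ ρ)) →
      IsNeumannSolution (sphericalCap ζ ρ) (capNormal ζ) F U →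
      ∀ ξ ∈ sphericalCap ζ ρ,
        U ξ = 1 / (2 * π * ρ) * (∫ η in sphericalCap ζ ρ, U η ∂surfaceMeasure) -
          ∫ η in boundaryOf (sphericalCap ζ ρ),
            (1 / (2 * π) * log (1 - ⟪ξ, η⟫) + (1 - ρ) / (2 * π * ρ) * log (2 - ρ)) * F η
              ∂lineMeasure := by
  have hζ1 : ‖ζ‖ = 1 := mem_sphere_zero_iff_norm.1 hζ
  obtain ⟨b, rfl⟩ := exists_orthonormal_frame hζ1
  -- The constant in the kernel is the value on ∂Γ of the term in log(1 + ζ·η) of G_N, since 1 + ζ·η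
  -- = 2-ρ there.
  exact ⟨isNeumannGreenFunction_cap hζ1 hρ, fun F U hF hU hsol ξ hξ =>
    neumannSolution_representation hρ hF hU hsol hξ _⟩
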